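/- Consider the $GI/M/m/n$ queue ($m\ge 1$ servers, $n\ge 0$ waiting places): interarrival times are i.i.d. with distribution function $A$ on $[0,\infty)$ and finite expectation $1/\lambda>0$, and service times are exponential with parameter $\mu>0$. Let $p_{m,n}$ be the stationary loss probability, i.e. the probability that an arriving customer finds $m+n$ customers present under the (unique) stationary distribution of the Markov chain of numbers of customers found by successive arrivals. Put $\varrho=\lambda/(m\mu)$, $\alpha(s)=\int_0^\infty e^{-sx}\,dA(x)$, $\varrho_k=\int_0^\infty(\mu m x)^k\,dA(x)$, $\varphi_j=\alpha(\mu j)$ and $C_j=\prod_{i=1}^j\frac{1-\varphi_i}{\varphi_i}$. Then for every $m\ge1$, as $n\to\infty$: (i) If $\varrho>1$, then $\lim_{n\to\infty}p_{m,n}=\frac{\varrho-1}{\varrho}$. (ii) If $\varrho=1$ and $\varrho_2<\infty$, then $\lim_{n\to\infty}n\,p_{m,n}=\frac{\varrho_2}{2}$. (iii) If $\varrho=1$ and $\varrho_3<\infty$, then $p_{m,n}=\frac{\varrho_2}{2n}+O\!\left(\frac{\log n}{n^2}\right)$. (iv) If $\varrho<1$, then the real equation $z=\alpha(\mu m-\mu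 m z)$ has a root $\sigma_m$ least in absolute value, $0<\sigma_m<1$, and, provided that $m(1-\sigma_m)\ne j$ for $1\le j\le m$ (so that no denominator in $K_m$ vanishes), $$\lim_{n\to\infty}\frac{p_{m,n}}{\sigma_m^n}=K_m\,[1+\mu m\,\alpha'(\mu m-\mu m\sigma_m)],$$ $$K_m=\left[1+(1-\sigma_m)\sum_{j=1}^m\frac{\binom mj C_j}{1-\varphi_j}\cdot\frac{m(1-\varphi_j)-j}{m(1-\sigma_m)-j}\right]^{-1}.$$ -/

import Mathlib

open MeasureTheory Filter Topology Asymptotics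

noncomputable section

namespace GIMmn

/-- The law of the number of customers in an `m`-server station with exponential service times of
rate `μ`, during a period without arrivals: `deathProb μ m i j x` is the probability that
`j` customers are present after time `x` if `i` customers were present at time `0`.
With `i` customers present, `min i m` servers are busy, so the time to the next departure is
exponential with rate `μ * min i m`; the definition conditions on the time `u` of this departure. -/
def deathProb (μ : ℝ) (m : ℕ) : ℕ → ℕ → ℝ → ℝ
  | 0, j, _ => if j = 0 then 1 else 0
  | i + 1, j, x =>
      if j = i + 1 then Real.exp (-(μ * (min (i + 1) m : ℕ)) * x)
      else ∫ u in (0 : ℝ)..x,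
        (μ * (min (i + 1) m : ℕ)) * Real.exp (-(μ * (min (i + 1) m : ℕ)) * u) *
          deathProb μ m i j (x - u)

/-- Transition matrix of the Markov chain of the numbers of customers found by successive
arrivals in the `GI/M/m/n` queue (`m` servers, `n` waiting places, interarrival law `A`,
service rate `μ`). An arrival that finds `i` customers raises the number to `i + 1`, except that it
is lost if `i = m + n`; then departures take place during one interarrival time. -/
def transition (μ : ℝ) (A : Measure ℝ) (m n : ℕ) :
    Matrix (Fin (m + n + 1)) (Fin (m + n + 1)) ℝ :=
  Matrix.of fun i j => ∫ x, deathProb μ m (min ((i : ℕ) + 1) (m + n)) (j : ℕ) x ∂A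

/-- `π` is a stationary distribution of the number of customers found by an arrival. -/
def IsStationary (μ : ℝ) (A : Measure ℝ) (m n : ℕ) (π : Fin (m + n + 1) → ℝ) : Prop :=
  π ∈ stdSimplex ℝ (Fin (m + n + 1)) ∧ Matrix.vecMul π (transition μ A m n) = π

/-- `p` is the stationary loss probability of the `GI/M/m/n` queue: the stationary probability that
an arrival finds all `m` servers and all `n` waiting places occupied. -/
def IsLossProb (μ : ℝ) (A : Measure ℝ) (m n : ℕ) (p : ℝ) : Prop :=
  ∃ π : Fin (m + n + 1) → ℝ, IsStationary μ A m n π ∧ p = π (Fin.last (m + n))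

/-- Arrival rate: the reciprocal of the expected interarrival time. -/
def arrivalRate (A : Measure ℝ) : ℝ := (∫ x, x ∂A)⁻¹

/-- The load of the system. -/
def load (μ : ℝ) (A : Measure ℝ) (m : ℕ) : ℝ := arrivalRate A / (m * μ)

/-- The moment of order `k` of the interarrival time, measured in units of `1 / (m * μ)`. -/
def rhoMoment (μ : ℝ) (A : Measure ℝ) (m k : ℕ) : ℝ := ∫ x, (μ * m * x) ^ k ∂A

/-- The Laplace–Stieltjes transform of the interarrival time. -/
def lst (A : Measure ℝ) (s : ℝ) : ℝ := ∫ x, Real.exp (-(s * x)) ∂A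

/-- `σ` is a real root of `z = α(μm - μmz)` that is least in absolute value. -/
def IsLeastRoot (μ : ℝ) (A : Measure ℝ) (m : ℕ) (σ : ℝ) : Prop :=
  σ = lst A (μ * m - μ * m * σ) ∧
    ∀ z : ℝ, z = lst A (μ * m - μ * m * z) → |σ| ≤ |z|

/-- `φ_j`, the value of the Laplace–Stieltjes transform at `μ * j`. -/
def phi (μ : ℝ) (A : Measure ℝ) (j : ℕ) : ℝ := lst A (μ * j)

/-- `C_j`, the product of `(1 - φ_i) / φ_i` over `1 ≤ i ≤ j`. -/
def coeffC (μ : ℝ) (A : Measure ℝ) (j : ℕ) : ℝ :=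
  ∏ i ∈ Finset.Icc 1 j, (1 - phi μ A i) / phi μ A i

/-- The constant `K_m`, as a function of the root `σ`. -/
def constK (μ : ℝ) (A : Measure ℝ) (m : ℕ) (σ : ℝ) : ℝ :=
  (1 + (1 - σ) * ∑ j ∈ Finset.Icc 1 m,
    ((m.choose j : ℝ) * coeffC μ A j / (1 - phi μ A j)) *
      ((m * (1 - phi μ A j) - j) / (m * (1 - σ) - j)))⁻¹

end GIMmn

end

/-! Count states from the top: `m + n - k` is the state `k` below the largest one. As long as all
servers are busy the departures form a Poisson process, so for states `≥ m` the flow balance across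
a level (`IsStationarySeq.cut`) is a renewal equation `r = b * r + a`, where `a k` is the probability
of `k` departures during an interarrival time with all servers busy, and `b` are the tails of `a`.
Hence the stationary probability of the state `m + n - k`, for `k ≤ n + 1`, is `r k` times the loss
probability, with `r` (`stateRatio`) independent of `n` (`IsStationarySeq.eq_stateRatio_mul`). The
states below `m - 1` have a mass of at most a constant times that of `m - 1`, since each state is
followed by the next larger one with a probability bounded below. Therefore
`1 / p n = r 0 + ⋯ + r (n + 1) + O(r (n + 1))` (`exists_inv_lossProb_eq`).

The sum of `b` is the mean of `a`, that is, `1 / ϱ`.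
* If `ϱ > 1`, the renewal equation is defective and the sum of `r` is `1 / (1 - 1 / ϱ)`.
* If `ϱ = 1`, the convolution of `r` with the tails `c` of `b` equals the partial sums of `a`
  (`IsRenewal.tail_conv`). So `r` is bounded, and a second summation compares `∑ i ≤ k, r i` with
  `k / ∑ c`, where `∑ c = ϱ₂ / 2`; the error is `o(k)` if `ϱ₂ < ∞`, and `O(1)` if `ϱ₃ < ∞`. The
  logarithm in the third assertion is thus not needed.
* If `ϱ < 1`, the sequence `r k * σ ^ k` solves a proper renewal equation, and it converges by the
  renewal theorem (`IsRenewal.tendsto_div`), whose proof follows the sequence along a filter on which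
  it tends to its upper limit. Seen from the state `m - 1`, the states above it thus have
  asymptotically geometric weights `σ ^ k`. The mass of the states below `m` follows from a
  first-order recursion for the binomial moments of the number of busy servers
  (`IsStationarySeq.binomial`, `IsStationarySeq.sum_lower_eq`); its inhomogeneous part converges by
  `hasSum_busyMoment`, and the sum of all masses gives `K_m`.

The law of the death process is used only through its Kolmogorov equation `hasDerivAt_deathProb`:
expectations of test functions are identified by checking that differential equation
(`deathMean_eq`). -/

namespace GIMmn

/-! ### The pure death process -/

/-- Total service rate in state `i`. -/
noncomputable def rate (μ : ℝ) (m i : ℕ) : ℝ := μ * (min i m : ℕ)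

lemma rate_nonneg {μ : ℝ} (hμ : 0 < μ) (m i : ℕ) : 0 ≤ rate μ m i := by
  unfold rate; positivity

lemma rate_of_le {m i : ℕ} (μ : ℝ) (h : i ≤ m) : rate μ m i = μ * i := by
  simp [rate, min_eq_left h]

lemma rate_of_ge {m i : ℕ} (μ : ℝ) (h : m ≤ i) : rate μ m i = μ * m := by
  simp [rate, min_eq_right h]

lemma deathProb_of_lt (μ : ℝ) (m : ℕ) {i j : ℕ} (h : i < j) (x : ℝ) :
    deathProb μ m i j x = 0 := by
  induction i generalizing x with
  | zero => simp [deathProb, h.ne']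
  | succ i ih =>
    have h1 : j ≠ i + 1 := h.ne'
    simp [deathProb, h1, ih (by omega)]

lemma deathProb_self (μ : ℝ) (m i : ℕ) (x : ℝ) :
    deathProb μ m i i x = Real.exp (-(rate μ m i * x)) := by
  cases i with
  | zero => simp [deathProb, rate]
  | succ i => simp [deathProb, rate]

lemma deathProb_zero (μ : ℝ) (m i j : ℕ) :
    deathProb μ m i j 0 = if j = i then 1 else 0 := by
  cases i with
  | zero => simp [deathProb]
  | succ i => simp [deathProb]

lemma deathProb_succ (μ : ℝ) (m : ℕ) {i j : ℕ} (h : j ≠ i + 1) (x : ℝ) :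
    deathProb μ m (i + 1) j x = Real.exp (-(rate μ m (i + 1) * x)) *
      ∫ v in (0 : ℝ)..x, rate μ m (i + 1) * Real.exp (rate μ m (i + 1) * v) *
        deathProb μ m i j v := by
  rw [deathProb, if_neg h]
  set c := rate μ m (i + 1) with hc
  have e : (μ * ((min (i + 1) m : ℕ) : ℝ)) = c := rfl
  rw [e]
  have := intervalIntegral.integral_comp_sub_left (a := 0) (b := x)
    (fun v => c * Real.exp (-c * (x - v)) * deathProb μ m i j v) x
  simp only [sub_sub_cancel, sub_zero, sub_self] at this
  rw [this, ← intervalIntegral.integral_const_mul]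
  congr 1
  ext v
  rw [show -c * (x - v) = -(c * x) + c * v by ring, Real.exp_add]
  ring

lemma hasDerivAt_exp_mul (c x : ℝ) :
    HasDerivAt (fun x => Real.exp (c * x)) (c * Real.exp (c * x)) x := by
  have h : HasDerivAt (fun x => c * x) c x := by simpa using (hasDerivAt_id x).const_mul c
  rw [mul_comm c]; exact h.exp

lemma hasDerivAt_exp_neg_mul (c x : ℝ) :
    HasDerivAt (fun x => Real.exp (-(c * x))) (-c * Real.exp (-(c * x))) x := by
  simpa [neg_mul] using hasDerivAt_exp_mul (-c) x

lemma hasDerivAt_deathProb_of_continuous (μ : ℝ) (m i j : ℕ)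
    (hc : Continuous (deathProb μ m i j)) (x : ℝ) :
    HasDerivAt (deathProb μ m (i + 1) j)
      (rate μ m (i + 1) * (deathProb μ m i j x - deathProb μ m (i + 1) j x)) x := by
  by_cases h : j = i + 1
  · subst h
    have e : deathProb μ m (i + 1) (i + 1) = fun x => Real.exp (-(rate μ m (i + 1) * x)) :=
      funext (deathProb_self μ m (i + 1))
    rw [e, deathProb_of_lt μ m (Nat.lt_succ_self i)]
    refine (hasDerivAt_exp_neg_mul (rate μ m (i + 1)) x).congr_deriv ?_
    ring
  · have e : deathProb μ m (i + 1) j = fun x => Real.exp (-(rate μ m (i + 1) * x)) *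
        ∫ v in (0 : ℝ)..x, rate μ m (i + 1) * Real.exp (rate μ m (i + 1) * v) *
          deathProb μ m i j v := funext (deathProb_succ μ m h)
    rw [e]
    set c := rate μ m (i + 1) with hcdef
    have h1 : Continuous fun v => c * Real.exp (c * v) * deathProb μ m i j v := by fun_prop
    have h2 := h1.integral_hasStrictDerivAt 0 x
    refine ((hasDerivAt_exp_neg_mul c x).fun_mul h2.hasDerivAt).congr_deriv ?_
    have : Real.exp (-(c * x)) * Real.exp (c * x) = 1 := by rw [← Real.exp_add]; simp
    linear_combination (c * deathProb μ m i j x) * this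

lemma continuous_deathProb (μ : ℝ) (m i j : ℕ) : Continuous (deathProb μ m i j) := by
  induction i with
  | zero =>
    have : deathProb μ m 0 j = fun _ => if j = 0 then 1 else 0 := by
      ext; simp [deathProb]
    rw [this]; exact continuous_const
  | succ i ih =>
    exact continuous_iff_continuousAt.2 fun x =>
      (hasDerivAt_deathProb_of_continuous μ m i j ih x).continuousAt

/-- The Kolmogorov backward equation of the death process, obtained from the decomposition at
the first departure. -/
lemma hasDerivAt_deathProb (μ : ℝ) (m i j : ℕ) (x : ℝ) :
    HasDerivAt (deathProb μ m (i + 1) j)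
      (rate μ m (i + 1) * (deathProb μ m i j x - deathProb μ m (i + 1) j x)) x :=
  hasDerivAt_deathProb_of_continuous μ m i j (continuous_deathProb μ m i j) x

/-- Uniqueness for the linear equation `y' = c (s - y)`, by the integrating factor `exp (c x)`. -/
lemma eq_of_hasDerivAt_linear {c : ℝ} {s y z : ℝ → ℝ}
    (hy : ∀ x, HasDerivAt y (c * (s x - y x)) x) (hz : ∀ x, HasDerivAt z (c * (s x - z x)) x)
    (h0 : y 0 = z 0) : y = z := by
  have h : ∀ x, HasDerivAt (fun x => Real.exp (c * x) * (y x - z x)) 0 x := fun x => by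
    refine ((hasDerivAt_exp_mul c x).fun_mul ((hy x).fun_sub (hz x))).congr_deriv ?_
    ring
  have h2 := is_const_of_deriv_eq_zero (fun x => (h x).differentiableAt) fun x => (h x).deriv
  ext x
  have h3 := h2 x 0
  simp only [h0, sub_self, mul_zero] at h3
  have := (mul_eq_zero.1 h3).resolve_left (Real.exp_pos _).ne'
  linarith

/-- Comparison: a solution of `y' + c y ≥ 0` that starts at a nonnegative value stays
nonnegative. -/
lemma nonneg_of_hasDerivAt {c : ℝ} {y s : ℝ → ℝ} (hs : ∀ x, 0 ≤ x → 0 ≤ s x)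
    (hy : ∀ x, HasDerivAt y (s x - c * y x) x) (h0 : 0 ≤ y 0) {x : ℝ} (hx : 0 ≤ x) : 0 ≤ y x := by
  have h : ∀ x, HasDerivAt (fun x => Real.exp (c * x) * y x) (Real.exp (c * x) * s x) x :=
    fun x => by
      refine ((hasDerivAt_exp_mul c x).fun_mul (hy x)).congr_deriv ?_
      ring
  have hmono : MonotoneOn (fun x => Real.exp (c * x) * y x) (Set.Ici 0) := by
    refine monotoneOn_of_deriv_nonneg (convex_Ici 0)
      (fun x _ => (h x).continuousAt.continuousWithinAt)
      (fun x _ => (h x).differentiableAt.differentiableWithinAt) fun x hx => ?_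
    rw [(h x).deriv]
    rw [interior_Ici] at hx
    exact mul_nonneg (Real.exp_pos _).le (hs x (le_of_lt hx))
  have h1 := hmono (Set.mem_Ici.2 le_rfl) (Set.mem_Ici.2 hx) hx
  simp only [mul_zero, Real.exp_zero, one_mul] at h1
  exact nonneg_of_mul_nonneg_right (h0.trans h1) (Real.exp_pos _)

lemma deathProb_nonneg {μ : ℝ} (hμ : 0 < μ) (m i j : ℕ) {x : ℝ} (hx : 0 ≤ x) :
    0 ≤ deathProb μ m i j x := by
  induction i generalizing x with
  | zero => simp only [deathProb]; split_ifs <;> norm_num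
  | succ i ih =>
    refine nonneg_of_hasDerivAt (c := rate μ m (i + 1))
      (s := fun x => rate μ m (i + 1) * deathProb μ m i j x)
      (fun x hx => mul_nonneg (rate_nonneg hμ _ _) (ih hx)) (fun x => ?_) ?_ hx
    · convert hasDerivAt_deathProb μ m i j x using 1
      ring
    · rw [deathProb_zero]; split_ifs <;> norm_num

/-- The expectation of `h` of the state at time `x` of the death process started at `i`. -/
noncomputable def deathMean (μ : ℝ) (m : ℕ) (h : ℕ → ℝ) (i : ℕ) (x : ℝ) : ℝ :=
  ∑ j ∈ Finset.range (i + 1), h j * deathProb μ m i j x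

lemma deathMean_eq_sum (μ : ℝ) (m : ℕ) (h : ℕ → ℝ) {i N : ℕ} (hi : i ≤ N) (x : ℝ) :
    deathMean μ m h i x = ∑ j ∈ Finset.range (N + 1), h j * deathProb μ m i j x := by
  refine Finset.sum_subset (fun j hj => ?_) fun j _ hj => ?_
  · simp only [Finset.mem_range] at *; omega
  · simp only [Finset.mem_range, not_lt] at hj
    rw [deathProb_of_lt μ m (by omega), mul_zero]

lemma deathMean_zero (μ : ℝ) (m : ℕ) (h : ℕ → ℝ) (i : ℕ) : deathMean μ m h i 0 = h i := by
  simp [deathMean, deathProb_zero]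

lemma deathMean_zero_left (μ : ℝ) (m : ℕ) (h : ℕ → ℝ) (x : ℝ) : deathMean μ m h 0 x = h 0 := by
  simp [deathMean, deathProb]

lemma hasDerivAt_deathMean (μ : ℝ) (m : ℕ) (h : ℕ → ℝ) (i : ℕ) (x : ℝ) :
    HasDerivAt (deathMean μ m h (i + 1))
      (rate μ m (i + 1) * (deathMean μ m h i x - deathMean μ m h (i + 1) x)) x := by
  rw [deathMean_eq_sum μ m h (Nat.le_succ i), deathMean, ← Finset.sum_sub_distrib, Finset.mul_sum]
  change HasDerivAt (fun x => ∑ j ∈ Finset.range (i + 1 + 1), h j * deathProb μ m (i + 1) j x) _ x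
  refine (HasDerivAt.fun_sum fun j _ =>
    (hasDerivAt_deathProb μ m i j x).const_mul (h j)).congr_deriv ?_
  refine Finset.sum_congr rfl fun j _ => ?_
  ring

/-- A family that solves the Kolmogorov equations with initial values `h` is the family of
expectations of `h`. -/
lemma deathMean_eq (μ : ℝ) (m : ℕ) (h : ℕ → ℝ) (M : ℕ) (G : ℕ → ℝ → ℝ)
    (hG0 : ∀ x, G 0 x = h 0) (hinit : ∀ i ≤ M, G i 0 = h i)
    (hder : ∀ i < M, ∀ x, HasDerivAt (G (i + 1)) (rate μ m (i + 1) * (G i x - G (i + 1) x)) x)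
    {i : ℕ} (hi : i ≤ M) : deathMean μ m h i = G i := by
  induction i with
  | zero => ext x; rw [hG0, deathMean_zero_left]
  | succ i ih =>
    refine eq_of_hasDerivAt_linear (hasDerivAt_deathMean μ m h i) (fun x => ?_) ?_
    · rw [ih (by omega)]; exact hder i (by omega) x
    · rw [deathMean_zero, hinit _ hi]

lemma sum_deathProb (μ : ℝ) (m i : ℕ) (x : ℝ) :
    ∑ j ∈ Finset.range (i + 1), deathProb μ m i j x = 1 := by
  have := deathMean_eq μ m (fun _ => 1) i (fun _ _ => 1) (fun _ => rfl) (fun _ _ => rfl)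
    (fun i _ x => by simpa using hasDerivAt_const x (1 : ℝ)) le_rfl
  simpa [deathMean] using congrFun this x

lemma deathMean_nonneg {μ : ℝ} (hμ : 0 < μ) (m : ℕ) {h : ℕ → ℝ} (hh : ∀ j, 0 ≤ h j) (i : ℕ)
    {x : ℝ} (hx : 0 ≤ x) : 0 ≤ deathMean μ m h i x :=
  Finset.sum_nonneg fun j _ => mul_nonneg (hh j) (deathProb_nonneg hμ m i j hx)

lemma deathMean_le {μ : ℝ} (hμ : 0 < μ) (m : ℕ) {h : ℕ → ℝ} {B : ℝ} (hh : ∀ j, h j ≤ B) (i : ℕ)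
    {x : ℝ} (hx : 0 ≤ x) : deathMean μ m h i x ≤ B := by
  calc deathMean μ m h i x ≤ ∑ j ∈ Finset.range (i + 1), B * deathProb μ m i j x :=
        Finset.sum_le_sum fun j _ =>
          mul_le_mul_of_nonneg_right (hh j) (deathProb_nonneg hμ m i j hx)
    _ = B := by rw [← Finset.mul_sum, sum_deathProb, mul_one]

/-- While all servers are busy, the departures form a Poisson process. -/
lemma deathProb_poisson (μ : ℝ) {m j : ℕ} (hj : m ≤ j) (k : ℕ) (x : ℝ) :
    deathProb μ m (j + k) j x = Real.exp (-(μ * m * x)) * (μ * m * x) ^ k / k.factorial := by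
  induction k generalizing x with
  | zero => simp [deathProb_self, rate_of_ge μ hj]
  | succ k ih =>
    have hr : rate μ m (j + k + 1) = μ * m := rate_of_ge μ (by omega)
    refine congrFun (f := deathProb μ m (j + (k + 1)) j)
      (g := fun x => Real.exp (-(μ * m * x)) * (μ * m * x) ^ (k + 1) / (k + 1).factorial)
      (eq_of_hasDerivAt_linear (c := μ * m) (s := deathProb μ m (j + k) j)
        (fun x => ?_) (fun x => ?_) ?_) x
    · have := hasDerivAt_deathProb μ m (j + k) j x
      rwa [hr] at this
    · rw [ih]
      have h2 : HasDerivAt (fun x : ℝ => (μ * m * x) ^ (k + 1))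
          ((k + 1 : ℕ) * (μ * m * x) ^ k * (μ * m)) x := by
        simpa using ((hasDerivAt_id x).const_mul (μ * m : ℝ)).fun_pow (k + 1)
      refine (((hasDerivAt_exp_neg_mul (μ * m) x).fun_mul h2).div_const
        ((k + 1).factorial : ℝ)).congr_deriv ?_
      rw [Nat.factorial_succ]
      have : (k.factorial : ℝ) ≠ 0 := by positivity
      push_cast
      field_simp
      ring
    · rw [← add_assoc, deathProb_zero, if_neg (by omega)]
      simp

/-- Up to state `m` the customers leave independently of each other, so the binomial moments of
their number decay exponentially. Only the values of `h` up to `m` matter. -/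
lemma deathMean_choose (μ : ℝ) (m r : ℕ) {h : ℕ → ℝ} (hh : ∀ j ≤ m, h j = j.choose r) {i : ℕ}
    (hi : i ≤ m) (x : ℝ) :
    deathMean μ m h i x = i.choose r * Real.exp (-(μ * r * x)) := by
  refine congrFun (deathMean_eq μ m h m (fun i x => i.choose r * Real.exp (-(μ * r * x)))
    (fun x => ?_) (fun i hi => ?_) (fun i hi x => ?_) hi) x
  · rw [hh 0 (Nat.zero_le _)]
    cases r <;> simp
  · simp [hh i hi]
  · rw [rate_of_le μ (by omega : i + 1 ≤ m)]
    refine ((hasDerivAt_exp_neg_mul (μ * r) x).const_mul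
      (((i + 1).choose r : ℕ) : ℝ)).congr_deriv ?_
    have : ((i + 1 : ℕ) : ℝ) * (i.choose r) = ((i + 1).choose r) * ((i + 1 : ℕ) - r : ℝ) := by
      by_cases hr : r ≤ i + 1
      · have h3 := Nat.choose_mul_succ_eq i r
        rw [← Nat.cast_sub hr]
        rw [mul_comm]
        exact_mod_cast h3
      · rw [Nat.choose_eq_zero_of_lt (by omega), Nat.choose_eq_zero_of_lt (by omega)]
        simp
    linear_combination (-(μ * Real.exp (-(μ * r * x)))) * this

/-! ### Discrete renewal equations -/

/-- `u` solves the renewal equation `u = f * u + g`. -/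
def IsRenewal (f g u : ℕ → ℝ) : Prop :=
  ∀ k, u k = ∑ l ∈ Finset.range (k + 1), f l * u (k - l) + g k

/-- The tails `∑_{j > k} a j` of a series with sum `s`. -/
def tail (s : ℝ) (a : ℕ → ℝ) (k : ℕ) : ℝ := s - ∑ j ∈ Finset.range (k + 1), a j

lemma tail_nonneg {s : ℝ} {a : ℕ → ℝ} (ha : ∀ j, 0 ≤ a j) (hs : HasSum a s) (k : ℕ) :
    0 ≤ tail s a k :=
  sub_nonneg.2 (sum_le_hasSum _ (fun j _ => ha j) hs)

lemma tail_succ (s : ℝ) (a : ℕ → ℝ) (k : ℕ) : tail s a (k + 1) = tail s a k - a (k + 1) := by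
  rw [tail, tail, Finset.sum_range_succ _ (k + 1)]; ring

lemma tail_zero (s : ℝ) (a : ℕ → ℝ) : tail s a 0 = s - a 0 := by simp [tail]

/-- Summation by parts: `∑ k, w k * ∑_{j > k} a j = ∑ j, a j * ∑_{k < j} w k`. -/
lemma hasSum_mul_tail {a w : ℕ → ℝ} {s t : ℝ} (ha : ∀ j, 0 ≤ a j) (hs : HasSum a s)
    (hw : ∀ k, 0 ≤ w k) (ht : HasSum (fun j => a j * ∑ k ∈ Finset.range j, w k) t) :
    HasSum (fun k => w k * tail s a k) t := by
  rw [hasSum_iff_tendsto_nat_of_nonneg (fun k => mul_nonneg (hw k) (tail_nonneg ha hs k))]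
  have key : ∀ K, ∑ k ∈ Finset.range K, w k * tail s a k =
      ∑ j ∈ Finset.range K, a j * ∑ k ∈ Finset.range j, w k +
        (∑ k ∈ Finset.range K, w k) * (s - ∑ j ∈ Finset.range K, a j) := by
    intro K
    induction K with
    | zero => simp
    | succ K ih =>
      rw [Finset.sum_range_succ, ih, tail, Finset.sum_range_succ _ K, Finset.sum_range_succ _ K,
        Finset.sum_range_succ _ K]
      ring
  have h1 := ht.tendsto_sum_nat
  have h2 : Tendsto (fun K => t - ∑ j ∈ Finset.range K, a j * ∑ k ∈ Finset.range j, w k)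
      atTop (𝓝 0) := by
    simpa using (tendsto_const_nhds (x := t)).sub h1
  have h3 : Tendsto (fun K => (∑ k ∈ Finset.range K, w k) * (s - ∑ j ∈ Finset.range K, a j))
      atTop (𝓝 0) := by
    refine squeeze_zero (fun K => mul_nonneg (Finset.sum_nonneg fun k _ => hw k)
      (sub_nonneg.2 (sum_le_hasSum _ (fun j _ => ha j) hs))) (fun K => ?_) h2
    have hs' := ((hasSum_nat_add_iff' K).2 hs).mul_left (∑ k ∈ Finset.range K, w k)
    have ht' := (hasSum_nat_add_iff' K).2 ht
    refine hasSum_le (fun j => ?_) hs' ht'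
    rw [mul_comm]
    refine mul_le_mul_of_nonneg_left ?_ (ha _)
    exact Finset.sum_le_sum_of_subset_of_nonneg (Finset.range_mono (Nat.le_add_left _ _))
      fun k _ _ => hw k
  simpa [key] using h1.add h3

namespace IsRenewal

variable {f g u : ℕ → ℝ}

lemma nonneg (h : IsRenewal f g u) (hf : ∀ k, 0 ≤ f k) (hg : ∀ k, 0 ≤ g k) (hf0 : f 0 < 1)
    (k : ℕ) : 0 ≤ u k := by
  induction k using Nat.strong_induction_on with
  | _ k ih =>
    have h1 := h k
    rw [Finset.sum_range_succ'] at h1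
    have h2 : 0 ≤ ∑ l ∈ Finset.range k, f (l + 1) * u (k - (l + 1)) :=
      Finset.sum_nonneg fun l hl =>
        mul_nonneg (hf _) (ih _ (by have := Finset.mem_range.1 hl; omega))
    have h3 : 0 ≤ (1 - f 0) * u k := by
      simp only [Nat.sub_zero] at h1
      nlinarith [hg k]
    exact nonneg_of_mul_nonneg_right h3 (by linarith)

/-- The tails of `f` convolved with `u` give the partial sums of `g`. -/
lemma tail_conv (h : IsRenewal f g u) (k : ℕ) :
    ∑ l ∈ Finset.range (k + 1), tail 1 f l * u (k - l) = ∑ j ∈ Finset.range (k + 1), g j := by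
  induction k with
  | zero =>
    have := h 0
    simp [tail] at this ⊢
    linarith
  | succ k ih =>
    rw [Finset.sum_range_succ g, ← ih, Finset.sum_range_succ']
    have h1 := h (k + 1)
    rw [Finset.sum_range_succ'] at h1
    simp only [tail_succ, tail_zero, Nat.add_sub_add_right, Nat.sub_zero, sub_mul,
      Finset.sum_sub_distrib] at h1 ⊢
    linarith

lemma le_of_hasSum (h : IsRenewal f g u) (hf : ∀ k, 0 ≤ f k) (hg : ∀ k, 0 ≤ g k)
    (hf1 : HasSum f 1) (hf0 : f 0 < 1) {γ : ℝ} (hγ : HasSum g γ) (k : ℕ) :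
    u k ≤ γ / (1 - f 0) := by
  rw [le_div_iff₀ (by linarith)]
  calc u k * (1 - f 0) = tail 1 f 0 * u (k - 0) := by rw [tail_zero, Nat.sub_zero, mul_comm]
    _ ≤ ∑ l ∈ Finset.range (k + 1), tail 1 f l * u (k - l) :=
        Finset.single_le_sum (f := fun l => tail 1 f l * u (k - l))
          (fun l _ => mul_nonneg (tail_nonneg hf hf1 l) (h.nonneg hf hg hf0 _)) (by simp)
    _ ≤ γ := by rw [h.tail_conv]; exact sum_le_hasSum _ (fun j _ => hg j) hγ

/-- In the defective case the total mass of the solution is finite. -/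
lemma hasSum_of_lt_one (h : IsRenewal f g u) (hf : ∀ k, 0 ≤ f k) (hg : ∀ k, 0 ≤ g k)
    {ρ γ : ℝ} (hfρ : HasSum f ρ) (hρ : ρ < 1) (hγ : HasSum g γ) :
    HasSum u (γ / (1 - ρ)) := by
  have hf0 : f 0 < 1 := (le_hasSum hfρ 0 fun j _ => hf j).trans_lt hρ
  have hu := h.nonneg hf hg hf0
  have hdef : ∀ k, ∑ l ∈ Finset.range (k + 1), f l * u (k - l) = u k - g k := fun k => by
    rw [h k]; ring
  have hsum : Summable u := by
    refine summable_of_sum_range_le (c := γ / (1 - ρ)) hu fun n => ?_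
    rw [le_div_iff₀ (by linarith)]
    have h1 : ∑ k ∈ Finset.range n, u k =
        ∑ k ∈ Finset.range n, ∑ l ∈ Finset.range (k + 1), f l * u (k - l) +
          ∑ k ∈ Finset.range n, g k := by
      rw [← Finset.sum_add_distrib]; exact Finset.sum_congr rfl fun k _ => h k
    have h2 : ∑ k ∈ Finset.range n, ∑ l ∈ Finset.range (k + 1), f l * u (k - l) ≤
        ρ * ∑ k ∈ Finset.range n, u k := by
      calc _ = ∑ l ∈ Finset.range n, ∑ k ∈ Finset.range (n - l), f l * u k := by
            rw [Finset.sum_sigma', Finset.sum_sigma']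
            refine Finset.sum_bij' (fun p _ => ⟨p.2, p.1 - p.2⟩) (fun p _ => ⟨p.1 + p.2, p.1⟩)
              ?_ ?_ ?_ ?_ ?_ <;> rintro ⟨a, b⟩ <;> simp <;> omega
        _ ≤ ∑ l ∈ Finset.range n, f l * ∑ k ∈ Finset.range n, u k := by
            refine Finset.sum_le_sum fun l _ => ?_
            rw [← Finset.mul_sum]
            exact mul_le_mul_of_nonneg_left (Finset.sum_le_sum_of_subset_of_nonneg
              (Finset.range_mono (Nat.sub_le _ _)) fun k _ _ => hu k) (hf l)
        _ ≤ _ := by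
            rw [← Finset.sum_mul]
            exact mul_le_mul_of_nonneg_right (sum_le_hasSum _ (fun j _ => hf j) hfρ)
              (Finset.sum_nonneg fun k _ => hu k)
    have h3 : ∑ k ∈ Finset.range n, g k ≤ γ := sum_le_hasSum _ (fun j _ => hg j) hγ
    linarith
  have h4 := tsum_mul_tsum_eq_tsum_sum_range_of_summable_norm hfρ.summable.norm hsum.norm
  simp only [hdef] at h4
  rw [hsum.tsum_sub hγ.summable, hfρ.tsum_eq, hγ.tsum_eq] at h4
  have h5 : ∑' k, u k = γ / (1 - ρ) := by
    rw [eq_div_iff (by linarith)]; linarith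
  rw [← h5]; exact hsum.hasSum

/-- Summed form of `tail_conv`. -/
lemma tail_conv_sum (h : IsRenewal f g u) (k : ℕ) :
    ∑ l ∈ Finset.range (k + 1), tail 1 f l * ∑ i ∈ Finset.range (k - l + 1), u i =
      ∑ j ∈ Finset.range (k + 1), ∑ i ∈ Finset.range (j + 1), g i := by
  induction k with
  | zero => simpa using h.tail_conv 0
  | succ k ih =>
    rw [Finset.sum_range_succ (fun j => ∑ i ∈ Finset.range (j + 1), g i), ← ih, ← h.tail_conv,
      Finset.sum_range_succ, Finset.sum_range_succ (fun l => tail 1 f l * u (k + 1 - l)),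
      ← add_assoc, ← Finset.sum_add_distrib]
    congr 1
    · refine Finset.sum_congr rfl fun l hl => ?_
      have := Finset.mem_range.1 hl
      rw [show k + 1 - l = k - l + 1 by omega, Finset.sum_range_succ, mul_add]
    · simp

lemma sum_mul_tail_bounds (h : IsRenewal f g u) (hf : ∀ k, 0 ≤ f k) (hf1 : HasSum f 1)
    (hu : ∀ k, 0 ≤ u k) {M : ℝ} (hM : ∀ k, u k ≤ M) (k : ℕ) :
    ∑ j ∈ Finset.range (k + 1), ∑ i ∈ Finset.range (j + 1), g i ≤
        (∑ i ∈ Finset.range (k + 1), u i) * ∑ l ∈ Finset.range (k + 1), tail 1 f l ∧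
      (∑ i ∈ Finset.range (k + 1), u i) * ∑ l ∈ Finset.range (k + 1), tail 1 f l ≤
        ∑ j ∈ Finset.range (k + 1), ∑ i ∈ Finset.range (j + 1), g i +
          M * ∑ l ∈ Finset.range (k + 1), l * tail 1 f l := by
  rw [← h.tail_conv_sum, Finset.mul_sum, Finset.mul_sum, ← Finset.sum_add_distrib]
  have key : ∀ l ∈ Finset.range (k + 1), ∑ i ∈ Finset.range (k - l + 1), u i ≤
      ∑ i ∈ Finset.range (k + 1), u i ∧ ∑ i ∈ Finset.range (k + 1), u i ≤
      ∑ i ∈ Finset.range (k - l + 1), u i + M * l := by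
    intro l hl
    have hl' := Finset.mem_range.1 hl
    have e : ∑ i ∈ Finset.range (k + 1), u i = ∑ i ∈ Finset.range (k - l + 1), u i +
        ∑ i ∈ Finset.range l, u (k - l + 1 + i) := by
      rw [← Finset.sum_range_add]; congr 2; omega
    have h1 : 0 ≤ ∑ i ∈ Finset.range l, u (k - l + 1 + i) := Finset.sum_nonneg fun i _ => hu _
    have h2 : ∑ i ∈ Finset.range l, u (k - l + 1 + i) ≤ M * l := by
      calc _ ≤ ∑ i ∈ Finset.range l, M := Finset.sum_le_sum fun i _ => hM _
        _ = _ := by simp [mul_comm]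
    constructor <;> linarith
  constructor
  · refine Finset.sum_le_sum fun l hl => ?_
    rw [mul_comm]
    exact mul_le_mul_of_nonneg_right (key l hl).1 (tail_nonneg hf hf1 l)
  · refine Finset.sum_le_sum fun l hl => ?_
    nlinarith [(key l hl).2, tail_nonneg hf hf1 l]

/-- Along any filter on which `u` tends to its upper limit, the shifted sequence has the same
limit: `u k` is an average of earlier values in which `u (k - 1)` has positive weight, and the
other values are asymptotically at most `L`. -/
lemma tendsto_pred (h : IsRenewal f g u) (hf : ∀ k, 0 ≤ f k) (hf1 : HasSum f 1)
    (hf1pos : 0 < f 1) (hg : Tendsto g atTop (𝓝 0)) {M : ℝ} (hM : ∀ k, |u k| ≤ M) {L : ℝ}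
    (hL : ∀ ε > 0, ∀ᶠ k in atTop, u k < L + ε) {F : Filter ℕ} (hF : F ≤ atTop)
    (hFL : Tendsto u F (𝓝 L)) : Tendsto (fun k => u (k - 1)) F (𝓝 L) := by
  -- the majorant `w` of `u` converges to `L`
  set w : ℕ → ℝ := fun k => max (u k) L with hw
  have hwL : Tendsto w atTop (𝓝 L) := by
    rw [Metric.tendsto_nhds]
    intro ε hε
    filter_upwards [hL ε hε] with k hk
    rw [Real.dist_eq, abs_lt]
    constructor
    · linarith [le_max_right (u k) L]
    · have : w k < L + ε := max_lt hk (by linarith)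
      linarith
  have hwb : ∀ k, |w k| ≤ M + |L| := fun k => by
    have h1 := hM k
    rw [abs_le] at h1 ⊢
    have := le_max_right (u k) L
    have := neg_abs_le L
    have := le_abs_self L
    have := abs_nonneg L
    have := (abs_nonneg (u k)).trans (hM k)
    exact ⟨by linarith, max_le (by linarith) (by linarith)⟩
  have hsub : ∀ l : ℕ, Tendsto (fun k : ℕ => k - l) atTop atTop := fun l => tendsto_sub_atTop_nat l
  set t : ℕ → ℕ → ℝ := fun k l => if l ≤ k ∧ l ≠ 1 then f l * w (k - l) else 0 with ht
  have h1 : Tendsto (fun k => ∑' l, t k l) atTop (𝓝 (∑' l, if l ≠ 1 then f l * L else 0)) := by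
    refine tendsto_tsum_of_dominated_convergence (bound := fun l => f l * (M + |L|))
      (hf1.summable.mul_right _) (fun l => ?_) (Eventually.of_forall fun k l => ?_)
    · by_cases hl : l = 1
      · simp [ht, hl]
      · simp only [ne_eq, hl, not_false_eq_true, if_true]
        refine ((hwL.comp (hsub l)).const_mul (f l)).congr' ?_
        filter_upwards [eventually_ge_atTop l] with k hk
        simp [ht, hk, hl]
    · simp only [ht]
      split_ifs
      · rw [Real.norm_eq_abs, abs_mul, abs_of_nonneg (hf l)]
        exact mul_le_mul_of_nonneg_left (hwb _) (hf l)
      · rw [norm_zero]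
        exact mul_nonneg (hf l) ((abs_nonneg _).trans (hwb 0))
  have h2 : (∑' l, if l ≠ 1 then f l * L else 0) = (1 - f 1) * L := by
    have h3 : HasSum (fun l => if l ≠ 1 then f l else 0) (1 - f 1) := by
      have h4 := hf1.sub (hasSum_ite_eq 1 (f 1))
      have e : (fun l => if l ≠ 1 then f l else 0) = fun l => f l - if l = 1 then f 1 else 0 := by
        ext l
        by_cases hl : l = 1 <;> simp [hl]
      rwa [e]
    have := (h3.mul_right L).tsum_eq
    simpa [ite_mul] using this
  have h3 : ∀ k, 1 ≤ k → u k ≤ f 1 * u (k - 1) + ∑' l, t k l + g k := by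
    intro k hk
    have h4 : ∑' l, t k l = ∑ l ∈ Finset.range (k + 1), t k l := by
      refine tsum_eq_sum fun l hl => ?_
      have : ¬ l ≤ k := by simpa using hl
      simp [ht, this]
    have h5 : ∑ l ∈ Finset.range (k + 1), f l * u (k - l) ≤
        ∑ l ∈ Finset.range (k + 1), ((if l = 1 then f 1 * u (k - 1) else 0) + t k l) := by
      refine Finset.sum_le_sum fun l hl => ?_
      have hl' : l ≤ k := by have := Finset.mem_range.1 hl; omega
      by_cases h1 : l = 1
      · simp [ht, h1]
      · simp only [h1, if_false, zero_add, ht, hl', ne_eq, not_false_eq_true, and_self, if_true]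
        exact mul_le_mul_of_nonneg_left (le_max_left _ _) (hf l)
    rw [Finset.sum_add_distrib, Finset.sum_ite_eq', if_pos (by simp; omega)] at h5
    rw [h k, h4]
    linarith
  have hlow : Tendsto (fun k => (u k - ∑' l, t k l - g k) / f 1) F (𝓝 L) := by
    have := ((hFL.sub (h1.mono_left hF)).sub (hg.mono_left hF)).div_const (f 1)
    rw [h2] at this
    convert this using 2
    field_simp
    ring
  refine tendsto_of_tendsto_of_tendsto_of_le_of_le' hlow ((hwL.comp (hsub 1)).mono_left hF) ?_ ?_
  · filter_upwards [hF (eventually_ge_atTop 1)] with k hk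
    rw [div_le_iff₀ hf1pos]
    linarith [h3 k hk]
  · exact Eventually.of_forall fun k => le_max_left _ _

/-- The upper limit of a bounded solution of the renewal equation is determined by the equation. -/
lemma limsup_mul_eq (h : IsRenewal f g u) (hf : ∀ k, 0 ≤ f k) (hf1 : HasSum f 1)
    (hf1pos : 0 < f 1) {γ κ : ℝ} (hγ : HasSum g γ) (hκ : HasSum (tail 1 f) κ)
    {M : ℝ} (hM : ∀ k, |u k| ≤ M) : limsup u atTop * κ = γ := by
  set L := limsup u atTop with hLdef
  have hb1 : IsBoundedUnder (· ≤ ·) atTop u :=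
    isBoundedUnder_of ⟨M, fun k => (abs_le.1 (hM k)).2⟩
  have hb2 : IsBoundedUnder (· ≥ ·) atTop u :=
    isBoundedUnder_of ⟨-M, fun k => (abs_le.1 (hM k)).1⟩
  have hL : ∀ ε > 0, ∀ᶠ k in atTop, u k < L + ε := fun ε hε =>
    eventually_lt_of_limsup_lt (by linarith) hb1
  -- a filter along which `u` tends to its upper limit
  set F : Filter ℕ := atTop ⊓ comap u (𝓝 L) with hFdef
  have hFne : F.NeBot := by
    rw [hFdef, Filter.neBot_inf_comap_iff_map, inf_comm]
    refine mapClusterPt_iff_frequently.2 fun s hs => ?_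
    obtain ⟨ε, hε, hball⟩ := Metric.mem_nhds_iff.1 hs
    refine ((frequently_lt_of_lt_limsup hb2.isCoboundedUnder_le
      (b := L - ε) (by linarith)).and_eventually (hL ε hε)).mono fun k hk => hball ?_
    rw [Metric.mem_ball, Real.dist_eq, abs_lt]
    constructor <;> linarith [hk.1, hk.2]
  have hF : F ≤ atTop := inf_le_left
  have hshift : ∀ l, Tendsto (fun k => u (k - l)) F (𝓝 L) := by
    have : ∀ l (G : Filter ℕ), G ≤ atTop → Tendsto u G (𝓝 L) →
        Tendsto (fun k => u (k - l)) G (𝓝 L) := by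
      intro l
      induction l with
      | zero => intro G _ h; simpa using h
      | succ l ih =>
        intro G hG hGL
        have h1 := h.tendsto_pred hf hf1 hf1pos hγ.summable.tendsto_atTop_zero hM hL hG hGL
        have h2 := ih (map (fun k => k - 1) G)
          ((map_mono hG).trans (tendsto_sub_atTop_nat 1)) (tendsto_map'_iff.2 h1)
        rw [tendsto_map'_iff] at h2
        refine h2.congr fun k => ?_
        simp [Nat.sub_sub, add_comm]
    exact fun l => this l F hF (tendsto_comap.mono_left inf_le_right)
  have h1 : Tendsto (fun k => ∑' l, if l ≤ k then tail 1 f l * u (k - l) else 0) F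
      (𝓝 (∑' l, tail 1 f l * L)) := by
    refine tendsto_tsum_of_dominated_convergence (bound := fun l => tail 1 f l * M)
      (hκ.summable.mul_right _) (fun l => ?_) (Eventually.of_forall fun k l => ?_)
    · refine ((hshift l).const_mul _).congr' ?_
      filter_upwards [hF (eventually_ge_atTop l)] with k hk
      simp [hk]
    · split_ifs
      · rw [Real.norm_eq_abs, abs_mul, abs_of_nonneg (tail_nonneg hf hf1 l)]
        exact mul_le_mul_of_nonneg_left (hM _) (tail_nonneg hf hf1 l)
      · rw [norm_zero]
        exact mul_nonneg (tail_nonneg hf hf1 l) ((abs_nonneg _).trans (hM 0))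
  have h2 : ∀ k, (∑' l, if l ≤ k then tail 1 f l * u (k - l) else 0) =
      ∑ j ∈ Finset.range (k + 1), g j := by
    intro k
    rw [← h.tail_conv, tsum_eq_sum (s := Finset.range (k + 1))]
    · refine Finset.sum_congr rfl fun l hl => ?_
      rw [if_pos (by have := Finset.mem_range.1 hl; omega)]
    · intro l hl
      rw [if_neg (by simpa using hl)]
  simp only [h2] at h1
  rw [tsum_mul_right, hκ.tsum_eq] at h1
  have h3 : Tendsto (fun k => ∑ j ∈ Finset.range (k + 1), g j) F (𝓝 γ) :=
    (hγ.tendsto_sum_nat.comp (tendsto_add_atTop_nat 1)).mono_left hF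
  rw [mul_comm]
  exact tendsto_nhds_unique h1 h3

lemma neg (h : IsRenewal f g u) : IsRenewal f (-g) (-u) := fun k => by
  simp only [Pi.neg_apply, mul_neg, Finset.sum_neg_distrib]
  rw [h k]; ring

/-- The renewal theorem, for a distribution `f` that charges `1`. -/
theorem tendsto_div (h : IsRenewal f g u) (hf : ∀ k, 0 ≤ f k) (hf1 : HasSum f 1)
    (hf1pos : 0 < f 1) {γ κ : ℝ} (hγ : HasSum g γ) (hκ : HasSum (tail 1 f) κ) (hκ0 : κ ≠ 0)
    {M : ℝ} (hM : ∀ k, |u k| ≤ M) : Tendsto u atTop (𝓝 (γ / κ)) := by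
  have h1 := h.limsup_mul_eq hf hf1 hf1pos hγ hκ hM
  have h2 := h.neg.limsup_mul_eq hf hf1 hf1pos hγ.neg hκ (M := M) (fun k => by simpa using hM k)
  have hb1 : IsBoundedUnder (· ≤ ·) atTop u :=
    isBoundedUnder_of ⟨M, fun k => (abs_le.1 (hM k)).2⟩
  have hb2 : IsBoundedUnder (· ≥ ·) atTop u :=
    isBoundedUnder_of ⟨-M, fun k => (abs_le.1 (hM k)).1⟩
  have hb3 : IsBoundedUnder (· ≤ ·) atTop (-u) :=
    isBoundedUnder_of ⟨M, fun k => by have := (abs_le.1 (hM k)).1; simp; linarith⟩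
  have e1 : limsup u atTop = γ / κ := by rw [eq_div_iff hκ0, h1]
  have e2 : limsup (-u) atTop = -(γ / κ) := by rw [← neg_div, eq_div_iff hκ0, h2]
  rw [Metric.tendsto_nhds]
  intro ε hε
  filter_upwards [eventually_lt_of_limsup_lt (b := γ / κ + ε) (by linarith) hb1,
    eventually_lt_of_limsup_lt (b := -(γ / κ) + ε) (by linarith) hb3] with k hk1 hk2
  rw [Real.dist_eq, abs_lt]
  simp only [Pi.neg_apply] at hk2
  constructor <;> linarith

end IsRenewal

lemma tendsto_sum_mul_div_zero {c : ℕ → ℝ} (hc : ∀ l, 0 ≤ c l) (hs : Summable c) :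
    Tendsto (fun k : ℕ => (∑ l ∈ Finset.range (k + 1), l * c l) / k) atTop (𝓝 0) := by
  have h1 : Tendsto (fun k : ℕ => ∑' l : ℕ, if l ≤ k then (l : ℝ) / k * c l else 0) atTop
      (𝓝 (∑' _ : ℕ, (0 : ℝ))) := by
    refine tendsto_tsum_of_dominated_convergence (bound := c) hs (fun l => ?_)
      (Eventually.of_forall fun k l => ?_)
    · have h2 := (tendsto_const_div_atTop_nhds_zero_nat (l : ℝ)).mul_const (c l)
      rw [zero_mul] at h2
      refine h2.congr' ?_
      filter_upwards [eventually_ge_atTop l] with k hk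
      simp [hk]
    · split_ifs with hl
      · rw [Real.norm_of_nonneg (mul_nonneg (by positivity) (hc l))]
        exact mul_le_of_le_one_left (hc l) (div_le_one_of_le₀ (by exact_mod_cast hl)
          (Nat.cast_nonneg k))
      · simpa using hc l
  rw [tsum_zero] at h1
  refine h1.congr fun k => ?_
  rw [tsum_eq_sum (s := Finset.range (k + 1)), Finset.sum_div]
  · refine Finset.sum_congr rfl fun l hl => ?_
    rw [if_pos (by have := Finset.mem_range.1 hl; omega)]
    ring
  · intro l hl
    rw [if_neg (by simpa using hl)]

/-! ### Departures during an interarrival time with all servers busy -/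

section Interarrival

variable {A : Measure ℝ} {μ : ℝ} {m : ℕ}

lemma ae_nonneg (hA : A (Set.Iio 0) = 0) : ∀ᵐ x ∂A, 0 ≤ x := by
  rw [ae_iff]
  simpa [Set.Iio] using hA

lemma lst_nonneg (s : ℝ) : 0 ≤ lst A s := integral_nonneg fun _ => (Real.exp_pos _).le

lemma integral_pos_of_pos (hA : A (Set.Iio 0) = 0) (hpos : 0 < ∫ x, x ∂A) {f : ℝ → ℝ}
    (hf : Integrable f A) (h0 : ∀ x, 0 ≤ x → 0 ≤ f x) (h1 : ∀ x, 0 < x → 0 < f x) :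
    0 < ∫ x, f x ∂A := by
  have hae : 0 ≤ᵐ[A] f := by
    filter_upwards [ae_nonneg hA] with x hx using h0 x hx
  rw [integral_pos_iff_support_of_nonneg_ae hae hf]
  by_contra hcon
  have h2 : A (Function.support f) = 0 := by simpa using hcon
  have h3 : A (Set.Ioi 0) = 0 := measure_mono_null (fun x hx => (h1 x hx).ne') h2
  have h4 : ∀ᵐ x ∂A, x = 0 := by
    have h5 : ∀ᵐ x ∂A, x ∉ Set.Ioi (0 : ℝ) := by rw [ae_iff]; simpa [Set.Ioi] using h3
    filter_upwards [ae_nonneg hA, h5] with x hx1 hx2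
    exact le_antisymm (by simpa using hx2) hx1
  rw [integral_congr_ae (g := fun _ => (0 : ℝ)) h4] at hpos
  simp at hpos

/-- The probability of `k` departures during an interarrival time if all servers stay busy. -/
noncomputable def departProb (μ : ℝ) (A : Measure ℝ) (m k : ℕ) : ℝ :=
  ∫ x, Real.exp (-(μ * m * x)) * (μ * m * x) ^ k / k.factorial ∂A

/-- Factorial moments and generating function of the number of departures. -/
lemma hasSum_departProb (hA : A (Set.Iio 0) = 0) (hμ : 0 < μ) (p : ℕ) {z : ℝ} (hz : 0 ≤ z)
    (hI : Integrable (fun x : ℝ => (μ * m * x) ^ p * Real.exp (-((1 - z) * (μ * m * x)))) A) :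
    HasSum (fun j : ℕ => (j.descFactorial p : ℝ) * departProb μ A m j * z ^ (j - p))
      (∫ x, (μ * m * x) ^ p * Real.exp (-((1 - z) * (μ * m * x))) ∂A) := by
  have hlim : ∀ x : ℝ, HasSum
      (fun k : ℕ => Real.exp (-(μ * m * x)) * (μ * m * x) ^ (k + p) / k.factorial * z ^ k)
      ((μ * m * x) ^ p * Real.exp (-((1 - z) * (μ * m * x)))) := by
    intro x
    have h1 : HasSum (fun k : ℕ => (μ * m * x * z) ^ k / k.factorial)
        (Real.exp (μ * m * x * z)) := by
      rw [Real.exp_eq_exp_ℝ]; exact NormedSpace.expSeries_div_hasSum_exp _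
    have h2 := h1.mul_left (Real.exp (-(μ * m * x)) * (μ * m * x) ^ p)
    have e : (μ * m * x) ^ p * Real.exp (-((1 - z) * (μ * m * x))) =
        Real.exp (-(μ * m * x)) * (μ * m * x) ^ p * Real.exp (μ * m * x * z) := by
      rw [show -((1 - z) * (μ * m * x)) = -(μ * m * x) + μ * m * x * z by ring, Real.exp_add]
      ring
    rw [e]
    refine h2.congr_fun ?_
    intro k
    rw [mul_pow _ z, pow_add]; ring
  have h := hasSum_integral_of_dominated_convergence (μ := A)
    (F := fun (k : ℕ) (x : ℝ) =>
      Real.exp (-(μ * m * x)) * (μ * m * x) ^ (k + p) / k.factorial * z ^ k)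
    (f := fun x => (μ * m * x) ^ p * Real.exp (-((1 - z) * (μ * m * x))))
    (fun k x => Real.exp (-(μ * m * x)) * (μ * m * x) ^ (k + p) / k.factorial * z ^ k)
    (fun k => Continuous.aestronglyMeasurable (by fun_prop))
    (fun k => by
      filter_upwards [ae_nonneg hA] with x hx
      rw [Real.norm_of_nonneg (by positivity)])
    (Eventually.of_forall fun x => (hlim x).summable)
    (hI.congr (Eventually.of_forall fun x => (hlim x).tsum_eq.symm))
    (Eventually.of_forall hlim)
  rw [← hasSum_nat_add_iff' p]
  have h0 : ∑ j ∈ Finset.range p,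
      (j.descFactorial p : ℝ) * departProb μ A m j * z ^ (j - p) = 0 :=
    Finset.sum_eq_zero fun j hj => by
      rw [Nat.descFactorial_of_lt (Finset.mem_range.1 hj)]; simp
  rw [h0, sub_zero]
  refine h.congr_fun ?_
  intro k
  rw [Nat.add_sub_cancel, departProb, ← integral_const_mul, ← integral_mul_const]
  refine integral_congr_ae (Eventually.of_forall fun x => ?_)
  have h3 : (k.factorial : ℝ) * ((k + p).descFactorial p) = (k + p).factorial := by
    have := Nat.factorial_mul_descFactorial (Nat.le_add_left p k)
    rw [Nat.add_sub_cancel] at this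
    exact_mod_cast this
  have h4 : (k.factorial : ℝ) ≠ 0 := by positivity
  have h5 : ((k + p).factorial : ℝ) ≠ 0 := by positivity
  simp only
  field_simp
  rw [← h3]
  ring

lemma hasSum_departProb_moment (hA : A (Set.Iio 0) = 0) (hμ : 0 < μ) (p : ℕ)
    (hI : Integrable (fun x : ℝ => (μ * m * x) ^ p) A) :
    HasSum (fun j : ℕ => (j.descFactorial p : ℝ) * departProb μ A m j) (rhoMoment μ A m p) := by
  simpa [rhoMoment] using hasSum_departProb hA hμ p zero_le_one (by simpa using hI)

variable [IsProbabilityMeasure A]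

/-- A function that is continuous and bounded on `[0, ∞)` is integrable. -/
lemma integrable_of_continuous_of_bdd (hA : A (Set.Iio 0) = 0) {f : ℝ → ℝ} (hf : Continuous f)
    {B : ℝ} (hB : ∀ x, 0 ≤ x → |f x| ≤ B) : Integrable f A :=
  (integrable_const B).mono' hf.aestronglyMeasurable
    (by filter_upwards [ae_nonneg hA] with x hx using hB x hx)

lemma integrable_exp_neg (hA : A (Set.Iio 0) = 0) {s : ℝ} (hs : 0 ≤ s) :
    Integrable (fun x => Real.exp (-(s * x))) A :=
  integrable_of_continuous_of_bdd hA (by fun_prop) (B := 1) fun x hx => by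
    rw [abs_of_pos (Real.exp_pos _), Real.exp_le_one_iff]
    have := mul_nonneg hs hx
    linarith

lemma lst_pos (hA : A (Set.Iio 0) = 0) {s : ℝ} (hs : 0 ≤ s) : 0 < lst A s :=
  integral_exp_pos (integrable_exp_neg hA hs)

lemma lst_lt_one (hA : A (Set.Iio 0) = 0) (hpos : 0 < ∫ x, x ∂A) {s : ℝ} (hs : 0 < s) :
    lst A s < 1 := by
  have hi := integrable_exp_neg hA hs.le
  have h : 0 < ∫ x, (1 - Real.exp (-(s * x))) ∂A :=
    integral_pos_of_pos hA hpos ((integrable_const 1).sub hi)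
      (fun x hx => by
        rw [sub_nonneg, Real.exp_le_one_iff]; have := mul_nonneg hs.le hx; linarith)
      (fun x hx => by
        rw [sub_pos, Real.exp_lt_one_iff]; have := mul_pos hs hx; linarith)
  rw [integral_sub (integrable_const 1) hi] at h
  simp only [integral_const, probReal_univ, smul_eq_mul, mul_one] at h
  exact sub_pos.1 h

lemma continuousOn_lst (hA : A (Set.Iio 0) = 0) : ContinuousOn (lst A) (Set.Ici 0) := by
  refine continuousOn_of_dominated (bound := fun _ => 1) (fun s _ => ?_) (fun s hs => ?_)
    (integrable_const 1) (Eventually.of_forall fun x => ?_)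
  · exact Continuous.aestronglyMeasurable (by fun_prop)
  · filter_upwards [ae_nonneg hA] with x hx
    rw [Real.norm_of_nonneg (Real.exp_pos _).le, Real.exp_le_one_iff]
    have := mul_nonneg (Set.mem_Ici.1 hs) hx
    linarith
  · exact Continuous.continuousOn (by fun_prop)

lemma hasDerivAt_lst (hA : A (Set.Iio 0) = 0) {s : ℝ} (hs : 0 < s) :
    HasDerivAt (lst A) (-∫ x, x * Real.exp (-(s * x)) ∂A) s := by
  have h1 : -s ∈ interior (ProbabilityTheory.integrableExpSet id A) := by
    refine interior_mono (s := Set.Iic 0) (fun t ht => ?_) (by simpa using hs)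
    have := integrable_exp_neg hA (s := -t) (by simpa using ht)
    simpa [ProbabilityTheory.integrableExpSet] using this
  have h2 := (ProbabilityTheory.hasDerivAt_mgf h1).scomp s (hasDerivAt_neg s)
  have e : lst A = ProbabilityTheory.mgf id A ∘ fun s => -s := by
    ext s; simp [lst, ProbabilityTheory.mgf]
  rw [e]
  refine h2.congr_deriv ?_
  simp

lemma exp_neg_mul_pow_div_le_one {y : ℝ} (hy : 0 ≤ y) (k : ℕ) :
    Real.exp (-y) * y ^ k / k.factorial ≤ 1 := by
  have h := Real.pow_div_factorial_le_exp y hy k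
  rw [mul_div_assoc, Real.exp_neg, inv_mul_le_iff₀ (Real.exp_pos y), mul_one]
  exact h

lemma integrable_departProb (hA : A (Set.Iio 0) = 0) (hμ : 0 < μ) (k : ℕ) :
    Integrable (fun x : ℝ => Real.exp (-(μ * m * x)) * (μ * m * x) ^ k / k.factorial) A :=
  integrable_of_continuous_of_bdd hA (by fun_prop) (B := 1) fun x hx => by
    have : 0 ≤ μ * m * x := by positivity
    rw [abs_of_nonneg (by positivity)]
    exact exp_neg_mul_pow_div_le_one this k

lemma departProb_pos (hA : A (Set.Iio 0) = 0) (hpos : 0 < ∫ x, x ∂A) (hμ : 0 < μ) (hm : 1 ≤ m)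
    (k : ℕ) : 0 < departProb μ A m k :=
  integral_pos_of_pos hA hpos (integrable_departProb hA hμ k) (fun x hx => by positivity)
    fun x hx => by positivity

lemma hasSum_departProb_one (hA : A (Set.Iio 0) = 0) (hμ : 0 < μ) :
    HasSum (departProb μ A m) 1 := by
  simpa [rhoMoment] using hasSum_departProb_moment (m := m) hA hμ 0 (by simp)

lemma hasSum_departProb_lst (hA : A (Set.Iio 0) = 0) (hμ : 0 < μ) {z : ℝ} (hz : 0 ≤ z)
    (hz1 : z ≤ 1) :
    HasSum (fun j => departProb μ A m j * z ^ j) (lst A (μ * m - μ * m * z)) := by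
  have e : ∀ x : ℝ, (1 - z) * (μ * m * x) = (μ * m - μ * m * z) * x := fun x => by ring
  have h0 : 0 ≤ μ * m - μ * m * z := by
    rw [← mul_one_sub]; exact mul_nonneg (by positivity) (by linarith)
  have := hasSum_departProb (m := m) hA hμ 0 hz (by
    simp only [pow_zero, one_mul, e]; exact integrable_exp_neg hA h0)
  simpa [lst, e] using this

/-- The probability of more than `k` departures during an interarrival time if all servers stay
busy. -/
noncomputable def departTail (μ : ℝ) (A : Measure ℝ) (m : ℕ) : ℕ → ℝ := tail 1 (departProb μ A m)

end Interarrival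

/-- The standing assumptions on the interarrival law `A`, the service rate `μ` and the number `m`
of servers. -/
structure IsQueue (μ : ℝ) (A : Measure ℝ) (m : ℕ) : Prop where
  nonneg : A (Set.Iio 0) = 0
  integrable : Integrable (fun x : ℝ => x) A
  mean_pos : 0 < ∫ x, x ∂A
  rate_pos : 0 < μ
  servers_pos : 1 ≤ m

namespace IsQueue

variable {μ : ℝ} {A : Measure ℝ} {m : ℕ}

lemma departTail_zero : departTail μ A m 0 = 1 - departProb μ A m 0 := tail_zero _ _

lemma rhoMoment_one : rhoMoment μ A m 1 = (load μ A m)⁻¹ := by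
  simp only [rhoMoment, load, arrivalRate, pow_one]
  rw [integral_const_mul]
  simp [mul_comm]

lemma load_pos (Q : IsQueue μ A m) : 0 < load μ A m := by
  have := Q.mean_pos
  have := Q.rate_pos
  have : (0 : ℝ) < m := by exact_mod_cast Q.servers_pos
  unfold load arrivalRate
  positivity

variable [IsProbabilityMeasure A]

lemma departProb_pos (Q : IsQueue μ A m) (k : ℕ) : 0 < departProb μ A m k :=
  GIMmn.departProb_pos Q.nonneg Q.mean_pos Q.rate_pos Q.servers_pos k

lemma hasSum_departProb (Q : IsQueue μ A m) : HasSum (departProb μ A m) 1 :=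
  hasSum_departProb_one Q.nonneg Q.rate_pos

lemma departTail_nonneg (Q : IsQueue μ A m) (k : ℕ) : 0 ≤ departTail μ A m k :=
  tail_nonneg (fun k => (Q.departProb_pos k).le) Q.hasSum_departProb k

lemma departTail_zero_lt_one (Q : IsQueue μ A m) : departTail μ A m 0 < 1 := by
  rw [departTail_zero]; linarith [Q.departProb_pos 0]

lemma departTail_pos (Q : IsQueue μ A m) (k : ℕ) : 0 < departTail μ A m k := by
  have h1 := Q.departTail_nonneg (k + 1)
  rw [departTail, tail_succ] at h1
  rw [departTail]
  linarith [Q.departProb_pos (k + 1)]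

/-- The tail probabilities sum to the mean number of departures. -/
lemma hasSum_departTail (Q : IsQueue μ A m) : HasSum (departTail μ A m) (load μ A m)⁻¹ := by
  have h := hasSum_departProb_moment (m := m) Q.nonneg Q.rate_pos 1
    (by simpa using Q.integrable.const_mul (μ * m))
  rw [rhoMoment_one] at h
  have := hasSum_mul_tail (w := fun _ => 1) (fun k => (Q.departProb_pos k).le) Q.hasSum_departProb
    (fun _ => zero_le_one) (t := (load μ A m)⁻¹) (by simpa [mul_comm] using h)
  simpa [departTail] using this

/-- The second tails sum to half of the second factorial moment. -/
lemma hasSum_tail_departTail (Q : IsQueue μ A m) (hρ : load μ A m = 1)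
    (h2 : Integrable (fun x : ℝ => (μ * m * x) ^ 2) A) :
    HasSum (tail 1 (departTail μ A m)) (rhoMoment μ A m 2 / 2) := by
  have hb : HasSum (departTail μ A m) 1 := by simpa [hρ] using Q.hasSum_departTail
  have h := (hasSum_departProb_moment (m := m) Q.nonneg Q.rate_pos 2 h2).div_const 2
  have hid : ∀ j : ℕ, ∑ k ∈ Finset.range j, (k : ℝ) = j.descFactorial 2 / 2 := by
    intro j
    induction j with
    | zero => simp
    | succ j ih =>
      rw [Finset.sum_range_succ, ih, Nat.succ_descFactorial_succ, Nat.descFactorial_one]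
      rcases j with _ | j
      · simp
      · rw [Nat.succ_descFactorial_succ, Nat.descFactorial_one]; push_cast; ring
  have h3 := hasSum_mul_tail (w := fun k => (k : ℝ)) (fun k => (Q.departProb_pos k).le)
    Q.hasSum_departProb (fun _ => Nat.cast_nonneg _) (t := rhoMoment μ A m 2 / 2) (by
      refine h.congr_fun fun j => ?_
      rw [hid]; ring)
  have h4 := hasSum_mul_tail (w := fun _ => 1) Q.departTail_nonneg hb
    (fun _ => zero_le_one) (t := rhoMoment μ A m 2 / 2) (by
      refine h3.congr_fun fun j => ?_
      simp [departTail, mul_comm])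
  simpa using h4

lemma summable_mul_tail_departTail (Q : IsQueue μ A m) (hρ : load μ A m = 1)
    (h3 : Integrable (fun x : ℝ => (μ * m * x) ^ 3) A) :
    Summable fun k : ℕ => (k : ℝ) * tail 1 (departTail μ A m) k := by
  have hb : HasSum (departTail μ A m) 1 := by simpa [hρ] using Q.hasSum_departTail
  have h := (hasSum_departProb_moment (m := m) Q.nonneg Q.rate_pos 3 h3)
  have hw : ∀ k : ℕ, (0 : ℝ) ≤ ∑ i ∈ Finset.range k, (i : ℝ) := fun k => by positivity
  have hid : ∀ j : ℕ, ∑ k ∈ Finset.range j, ∑ i ∈ Finset.range k, (i : ℝ) ≤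
      j.descFactorial 3 := by
    intro j
    have : ∀ j : ℕ, ∑ k ∈ Finset.range j, ∑ i ∈ Finset.range k, (i : ℝ) =
        j * (j - 1) * (j - 2) / 6 := by
      intro j
      have h2 : ∀ j : ℕ, ∑ k ∈ Finset.range j, (k : ℝ) = j * (j - 1) / 2 := by
        intro j
        induction j with
        | zero => simp
        | succ j ih => rw [Finset.sum_range_succ, ih]; push_cast; ring
      induction j with
      | zero => simp
      | succ j ih => rw [Finset.sum_range_succ, ih, h2]; push_cast; ring
    have h0 : (0 : ℝ) ≤ ∑ k ∈ Finset.range j, ∑ i ∈ Finset.range k, (i : ℝ) := by positivity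
    have e : ((j.descFactorial 3 : ℕ) : ℝ) = j * (j - 1) * (j - 2) := by
      rcases j with _ | _ | _ | j
      · simp
      · simp
      · simp [Nat.descFactorial]
      · simp only [Nat.descFactorial, Nat.sub_zero]
        push_cast [show j + 1 + 1 + 1 - 1 = j + 2 by omega, show j + 1 + 1 + 1 - 2 = j + 1 by omega]
        ring
    rw [this] at h0 ⊢
    rw [e]
    linarith
  have h4 : Summable fun j : ℕ =>
      departProb μ A m j * ∑ k ∈ Finset.range j, ∑ i ∈ Finset.range k, (i : ℝ) := by
    refine Summable.of_nonneg_of_le (fun j => mul_nonneg (Q.departProb_pos j).le (by positivity))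
      (fun j => ?_) h.summable
    rw [mul_comm]
    exact mul_le_mul_of_nonneg_right (hid j) (Q.departProb_pos j).le
  have h5 := hasSum_mul_tail (fun k => (Q.departProb_pos k).le) Q.hasSum_departProb hw h4.hasSum
  have h6 := hasSum_mul_tail (w := fun k => (k : ℝ)) Q.departTail_nonneg hb
    (fun _ => Nat.cast_nonneg _) (h5.congr_fun fun j => by rw [departTail, mul_comm])
  exact h6.summable

/-- Generating function of the tail probabilities. -/
lemma hasSum_departTail_pow (Q : IsQueue μ A m) {z : ℝ} (hz : 0 ≤ z) (hz1 : z < 1) :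
    HasSum (fun k => departTail μ A m k * z ^ k)
      ((1 - lst A (μ * m - μ * m * z)) / (1 - z)) := by
  have h := (Q.hasSum_departProb.sub
    (hasSum_departProb_lst (m := m) Q.nonneg Q.rate_pos hz hz1.le)).div_const (1 - z)
  have h2 := hasSum_mul_tail (w := fun k => z ^ k) (fun k => (Q.departProb_pos k).le)
    Q.hasSum_departProb (fun _ => pow_nonneg hz _) (h.congr_fun fun j => by
      rw [geom_sum_eq hz1.ne, ← neg_div_neg_eq]; ring)
  exact h2.congr_fun fun k => by rw [departTail, mul_comm]

/-- If the load is below one, the equation `z = α (μ m - μ m z)` has a root in `(0, 1)`; the least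
one is the root of least absolute value, since `α` is nonnegative. -/
lemma exists_isLeastRoot (Q : IsQueue μ A m) (hρ : load μ A m < 1) :
    ∃ σ : ℝ, IsLeastRoot μ A m σ ∧ σ ∈ Set.Ioo (0 : ℝ) 1 := by
  have hmμ : 0 < μ * m := mul_pos Q.rate_pos (by exact_mod_cast Q.servers_pos)
  have hcont : ContinuousOn (fun z => lst A (μ * m - μ * m * z) - z) (Set.Icc 0 1) := by
    refine ContinuousOn.sub ((continuousOn_lst Q.nonneg).comp (by fun_prop) fun z hz => ?_)
      continuousOn_id
    have := mul_le_mul_of_nonneg_left hz.2 hmμ.le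
    simp only [Set.mem_Ici]; linarith
  -- near `1` the generating function lies below the diagonal
  obtain ⟨z₀, hz₀, hneg⟩ : ∃ z₀ ∈ Set.Ioo (0 : ℝ) 1, lst A (μ * m - μ * m * z₀) - z₀ < 0 := by
    have h1 : 1 < (load μ A m)⁻¹ := (one_lt_inv₀ Q.load_pos).2 hρ
    obtain ⟨K, hK⟩ := ((Q.hasSum_departTail.tendsto_sum_nat).eventually_const_lt h1).exists
    have h2 : ContinuousAt (fun z : ℝ => ∑ k ∈ Finset.range K, departTail μ A m k * z ^ k) 1 := by
      fun_prop
    have h3 : ∀ᶠ z in 𝓝[<] (1 : ℝ), 1 < ∑ k ∈ Finset.range K, departTail μ A m k * z ^ k :=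
      (h2.eventually_const_lt (by simpa using hK)).filter_mono nhdsWithin_le_nhds
    obtain ⟨z, hz, hz0⟩ := (h3.and (Ioo_mem_nhdsLT (zero_lt_one' ℝ))).exists
    refine ⟨z, hz0, ?_⟩
    have h4 := sum_le_hasSum (Finset.range K)
      (fun k _ => mul_nonneg (Q.departTail_nonneg k) (pow_nonneg hz0.1.le k))
      (Q.hasSum_departTail_pow hz0.1.le hz0.2)
    have h5 := (lt_div_iff₀ (by linarith [hz0.2])).1 (hz.trans_le h4)
    linarith
  set S : Set ℝ := {z ∈ Set.Icc 0 1 | lst A (μ * m - μ * m * z) - z ∈ ({0} : Set ℝ)} with hS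
  have hScl : IsCompact S :=
    isCompact_Icc.of_isClosed_subset (hcont.preimage_isClosed_of_isClosed isClosed_Icc
      isClosed_singleton) fun z hz => hz.1
  have hroot : ∃ z ∈ S, z < 1 := by
    have := intermediate_value_Icc' hz₀.1.le
      (hcont.mono (Set.Icc_subset_Icc_right hz₀.2.le))
    obtain ⟨z, hz, hz2⟩ := this (show (0 : ℝ) ∈ _ from
      ⟨hneg.le, by simpa using lst_nonneg _⟩)
    exact ⟨z, ⟨⟨hz.1, hz.2.trans hz₀.2.le⟩, hz2⟩, hz.2.trans_lt hz₀.2⟩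
  obtain ⟨z₁, hz₁, hz₁1⟩ := hroot
  obtain ⟨σ, hσ, hmin⟩ := hScl.exists_isLeast ⟨z₁, hz₁⟩
  have hσeq : σ = lst A (μ * m - μ * m * σ) := by
    have := hσ.2
    simp only [Set.mem_singleton_iff] at this
    linarith
  have hσ1 : σ < 1 := (hmin hz₁).trans_lt hz₁1
  have hσ0 : 0 < σ := by
    rw [hσeq]
    refine lst_pos Q.nonneg ?_
    have := mul_le_mul_of_nonneg_left hσ1.le hmμ.le
    linarith
  refine ⟨σ, ⟨hσeq, fun z hz => ?_⟩, hσ0, hσ1⟩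
  have hz0 : 0 ≤ z := by rw [hz]; exact lst_nonneg _
  rw [abs_of_pos hσ0, abs_of_nonneg hz0]
  rcases le_or_gt z 1 with h | h
  · exact hmin ⟨⟨hz0, h⟩, by simp only [Set.mem_singleton_iff]; linarith⟩
  · linarith

/-- The mean of the distribution `b k * σ ^ k` obtained by tilting the tails `b`. The numerator is
`σ` times one minus the derivative of the generating function of the departures at its fixed point
`σ`. -/
lemma hasSum_tail_tilted (Q : IsQueue μ A m) {σ : ℝ} (hσ : σ = lst A (μ * m - μ * m * σ)) (hσ0 : 0 < σ) (hσ1 : σ < 1) :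
    HasSum (tail 1 fun k => departTail μ A m k * σ ^ k)
      (σ * (1 + μ * m * deriv (lst A) (μ * m - μ * m * σ)) / (1 - σ)) := by
  have hmμ : 0 < μ * m := mul_pos Q.rate_pos (by exact_mod_cast Q.servers_pos)
  have hs : 0 < μ * m - μ * m * σ := by nlinarith
  have hσ' : 1 - σ ≠ 0 := by linarith
  have hbt : HasSum (fun k => departTail μ A m k * σ ^ k) 1 := by
    have := Q.hasSum_departTail_pow hσ0.le hσ1
    rwa [← hσ, div_self hσ'] at this
  have e : ∀ x : ℝ, (1 - σ) * (μ * m * x) = (μ * m - μ * m * σ) * x := fun x => by ring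
  have hI : Integrable (fun x : ℝ => (μ * m * x) ^ 1 * Real.exp (-((1 - σ) * (μ * m * x)))) A := by
    simp only [pow_one, e]
    refine (Q.integrable.const_mul (μ * m)).mul_bdd (c := 1)
      (Continuous.aestronglyMeasurable (by fun_prop)) ?_
    filter_upwards [ae_nonneg Q.nonneg] with x hx
    rw [Real.norm_of_nonneg (Real.exp_pos _).le, Real.exp_le_one_iff]
    have := mul_nonneg hs.le hx
    linarith
  set d := ∫ x, (μ * m * x) ^ 1 * Real.exp (-((1 - σ) * (μ * m * x))) ∂A with hd
  have hderiv : μ * m * deriv (lst A) (μ * m - μ * m * σ) = -d := by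
    rw [(hasDerivAt_lst Q.nonneg hs).deriv, hd, mul_neg, ← integral_const_mul]
    congr 1
    refine integral_congr_ae (Eventually.of_forall fun x => ?_)
    simp only [pow_one, e]
    ring
  have h1 := GIMmn.hasSum_departProb Q.nonneg Q.rate_pos 1 hσ0.le hI
  have h0 := hasSum_departProb_lst (m := m) Q.nonneg Q.rate_pos hσ0.le hσ1.le
  rw [← hσ] at h0
  simp only [Nat.descFactorial_one] at h1
  have hid : ∀ j : ℕ, ∑ k ∈ Finset.range j, (k : ℝ) * σ ^ k =
      (σ - j * σ ^ (j - 1) * (σ * (1 - σ)) - σ * σ ^ j) / (1 - σ) ^ 2 := by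
    intro j
    rw [eq_div_iff (pow_ne_zero _ hσ')]
    induction j with
    | zero => simp
    | succ j ih =>
      rw [Finset.sum_range_succ, add_mul, ih]
      rcases j with _ | j
      · simp; ring
      · simp only [Nat.add_sub_cancel]; push_cast; ring
  have h2 := ((Q.hasSum_departProb.mul_right σ).sub (h1.mul_right (σ * (1 - σ)))).sub
    (h0.mul_right σ) |>.div_const ((1 - σ) ^ 2)
  have h3 := hasSum_mul_tail (w := fun k : ℕ => (k : ℝ) * σ ^ k)
    (fun k => (Q.departProb_pos k).le) Q.hasSum_departProb
    (fun k => mul_nonneg (Nat.cast_nonneg _) (pow_nonneg hσ0.le _)) (h2.congr_fun fun j => by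
      rw [hid]; ring)
  have h4 := hasSum_mul_tail (w := fun _ => 1)
    (fun k => mul_nonneg (Q.departTail_nonneg k) (pow_nonneg hσ0.le k)) hbt
    (fun _ => zero_le_one) (h3.congr_fun fun j => by
      simp [departTail]; ring)
  rw [hderiv]
  have e2 : (1 * σ - d * (σ * (1 - σ)) - σ * σ) / (1 - σ) ^ 2 = σ * (1 + -d) / (1 - σ) := by
    field_simp
    ring
  rw [e2] at h4
  simpa using h4

end IsQueue

/-! ### Stationary distributions of finite chains -/

section Chain

variable {N : ℕ} {P : Matrix (Fin (N + 1)) (Fin (N + 1)) ℝ}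

/-- The absolute value of a signed stationary vector of a stochastic matrix is stationary. -/
lemma vecMul_abs_eq (h0 : ∀ i j, 0 ≤ P i j) (h1 : ∀ i, ∑ j, P i j = 1) {v : Fin (N + 1) → ℝ}
    (hv : Matrix.vecMul v P = v) : Matrix.vecMul |v| P = |v| := by
  have hle : ∀ j ∈ Finset.univ, |v| j ≤ Matrix.vecMul |v| P j := fun j _ => by
    have : v j = ∑ i, v i * P i j := (congrFun hv j).symm
    rw [Pi.abs_apply, this]
    refine (Finset.abs_sum_le_sum_abs _ _).trans (le_of_eq ?_)
    refine Finset.sum_congr rfl fun i _ => ?_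
    rw [abs_mul, abs_of_nonneg (h0 i j)]; rfl
  have hsum : ∑ j, |v| j = ∑ j, Matrix.vecMul |v| P j := by
    simp only [Matrix.vecMul, dotProduct]
    rw [Finset.sum_comm]
    simp only [← Finset.mul_sum, h1, mul_one]
  ext j
  exact ((Finset.sum_eq_sum_iff_of_le hle).1 hsum j (Finset.mem_univ j)).symm

lemma last_pos_of_vecMul_eq (h0 : ∀ i j, 0 ≤ P i j) (h2 : ∀ i : Fin N, 0 < P i.castSucc i.succ)
    {u : Fin (N + 1) → ℝ} (hu0 : ∀ i, 0 ≤ u i) (hu : Matrix.vecMul u P = u) (hne : u ≠ 0) :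
    0 < u (Fin.last N) := by
  obtain ⟨i, hi⟩ := Function.ne_iff.1 hne
  have hi' : 0 < u i := lt_of_le_of_ne (hu0 i) (Ne.symm hi)
  clear hi
  induction i using Fin.reverseInduction with
  | last => exact hi'
  | cast i ih =>
    apply ih
    have : u i.succ = ∑ k, u k * P k i.succ := (congrFun hu _).symm
    rw [this]
    exact Finset.sum_pos' (fun k _ => mul_nonneg (hu0 k) (h0 _ _))
      ⟨i.castSucc, Finset.mem_univ _, mul_pos hi' (h2 i)⟩

/-- A stochastic matrix on `{0, …, N}` in which every state can be followed by the next larger one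
has exactly one stationary distribution. -/
theorem existsUnique_stationary (h0 : ∀ i j, 0 ≤ P i j) (h1 : ∀ i, ∑ j, P i j = 1)
    (h2 : ∀ i : Fin N, 0 < P i.castSucc i.succ) :
    ∃! π : Fin (N + 1) → ℝ, π ∈ stdSimplex ℝ (Fin (N + 1)) ∧ Matrix.vecMul π P = π := by
  have hdet : (P - 1).det = 0 := by
    refine Matrix.exists_mulVec_eq_zero_iff.1 ⟨1, one_ne_zero, ?_⟩
    ext i
    rw [Matrix.sub_mulVec, Matrix.one_mulVec]
    simp [Matrix.mulVec, dotProduct, h1]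
  obtain ⟨v, hv0, hv⟩ := Matrix.exists_vecMul_eq_zero_iff.2 hdet
  rw [Matrix.vecMul_sub, Matrix.vecMul_one, sub_eq_zero] at hv
  have hpos : 0 < ∑ i, |v| i := by
    obtain ⟨i, hi⟩ := Function.ne_iff.1 hv0
    exact Finset.sum_pos' (fun i _ => abs_nonneg _) ⟨i, Finset.mem_univ i, abs_pos.2 hi⟩
  refine existsUnique_of_exists_of_unique
    ⟨(∑ i, |v| i)⁻¹ • |v|, ⟨fun i => ?_, ?_⟩, ?_⟩ fun π π' hπ hπ' => ?_
  · exact mul_nonneg (inv_nonneg.2 hpos.le) (abs_nonneg _)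
  · simp only [Pi.smul_apply, smul_eq_mul, ← Finset.mul_sum]
    exact inv_mul_cancel₀ hpos.ne'
  · rw [Matrix.smul_vecMul, vecMul_abs_eq h0 h1 hv]
  · -- the positive and the negative part of the difference cannot both charge the largest state
    set d := π - π' with hd
    have hdP : Matrix.vecMul d P = d := by rw [hd, Matrix.sub_vecMul, hπ.2, hπ'.2]
    have hdsum : ∑ i, d i = 0 := by simp [hd, hπ.1.2, hπ'.1.2]
    have habs := vecMul_abs_eq h0 h1 hdP
    have hplus : |d| + d = 0 ∨ |d| - d = 0 := by
      by_contra! hcon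
      have e1 := last_pos_of_vecMul_eq h0 h2 (u := |d| + d)
        (fun i => by have := neg_abs_le (d i); simp only [Pi.add_apply, Pi.abs_apply]; linarith)
        (by rw [Matrix.add_vecMul, habs, hdP]) hcon.1
      have e2 := last_pos_of_vecMul_eq h0 h2 (u := |d| - d)
        (fun i => by have := le_abs_self (d i); simp only [Pi.sub_apply, Pi.abs_apply]; linarith)
        (by rw [Matrix.sub_vecMul, habs, hdP]) hcon.2
      simp only [Pi.add_apply, Pi.sub_apply, Pi.abs_apply] at e1 e2
      rcases abs_cases (d (Fin.last N)) with h | h <;> linarith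
    have habs0 : ∑ i, |d i| = 0 := by
      rcases hplus with h | h
      · have : ∀ i, |d i| = -d i := fun i => eq_neg_of_add_eq_zero_left (congrFun h i)
        simp [this, hdsum]
      · have : ∀ i, |d i| = d i := fun i => sub_eq_zero.1 (congrFun h i)
        simp [this, hdsum]
    have hd0 : d = 0 := by
      ext i
      exact abs_eq_zero.1
        ((Finset.sum_eq_zero_iff_of_nonneg fun i _ => abs_nonneg (d i)).1 habs0 i (by simp))
    exact sub_eq_zero.1 hd0

end Chain

/-! ### Balance equations of the queue -/

/-- A sequence on `ℕ` that restricts to a stationary distribution on `{0, …, m + n}`, described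
through its action on test functions. -/
structure IsStationarySeq (μ : ℝ) (A : Measure ℝ) (m n : ℕ) (q : ℕ → ℝ) : Prop where
  nonneg : ∀ i, 0 ≤ q i
  sum_eq_one : ∑ i ∈ Finset.range (m + n + 1), q i = 1
  balance : ∀ h : ℕ → ℝ, ∑ i ∈ Finset.range (m + n + 1), q i * h i =
    ∑ i ∈ Finset.range (m + n + 1), q i * ∫ x, deathMean μ m h (min (i + 1) (m + n)) x ∂A

section Queue

variable {μ : ℝ} {A : Measure ℝ} {m : ℕ}

lemma transition_nonneg (Q : IsQueue μ A m) (n : ℕ) (i j : Fin (m + n + 1)) :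
    0 ≤ transition μ A m n i j :=
  integral_nonneg_of_ae (by
    filter_upwards [ae_nonneg Q.nonneg] with x hx using deathProb_nonneg Q.rate_pos _ _ _ hx)

variable [IsProbabilityMeasure A]

lemma integrable_deathProb (Q : IsQueue μ A m) (i j : ℕ) :
    Integrable (fun x => deathProb μ m i j x) A := by
  refine integrable_of_continuous_of_bdd Q.nonneg (continuous_deathProb μ m i j) (B := 1)
    fun x hx => ?_
  rw [abs_of_nonneg (deathProb_nonneg Q.rate_pos m i j hx)]
  by_cases hj : j ≤ i
  · rw [← sum_deathProb μ m i x]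
    exact Finset.single_le_sum (fun j _ => deathProb_nonneg Q.rate_pos m i j hx)
      (Finset.mem_range.2 (by omega))
  · rw [deathProb_of_lt μ m (by omega)]; exact zero_le_one

lemma integrable_deathMean (Q : IsQueue μ A m) (h : ℕ → ℝ) (i : ℕ) :
    Integrable (fun x => deathMean μ m h i x) A :=
  integrable_finsetSum _ fun j _ => (integrable_deathProb Q i j).const_mul _

lemma sum_mul_transition (Q : IsQueue μ A m) (n : ℕ) (h : ℕ → ℝ) (i : Fin (m + n + 1)) :
    ∑ j : Fin (m + n + 1), transition μ A m n i j * h j =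
      ∫ x, deathMean μ m h (min ((i : ℕ) + 1) (m + n)) x ∂A := by
  simp only [deathMean_eq_sum μ m h (min_le_right ((i : ℕ) + 1) (m + n))]
  rw [integral_finsetSum _ fun j _ => (integrable_deathProb Q _ j).const_mul _,
    ← Fin.sum_univ_eq_sum_range
      (fun j => ∫ x, h j * deathProb μ m (min ((i : ℕ) + 1) (m + n)) j x ∂A)]
  refine Finset.sum_congr rfl fun j _ => ?_
  rw [integral_const_mul, mul_comm]
  rfl

/-- The probability of no departure from a state `i` is at least that with all servers busy. -/
lemma departProb_zero_le (Q : IsQueue μ A m) (i : ℕ) :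
    departProb μ A m 0 ≤ ∫ x, deathProb μ m i i x ∂A := by
  refine integral_mono_ae (integrable_departProb Q.nonneg Q.rate_pos 0)
    (integrable_deathProb Q i i) ?_
  filter_upwards [ae_nonneg Q.nonneg] with x hx
  simp only [pow_zero, Nat.factorial_zero, Nat.cast_one, mul_one, div_one, deathProb_self]
  refine Real.exp_le_exp.2 (neg_le_neg (mul_le_mul_of_nonneg_right ?_ hx))
  exact mul_le_mul_of_nonneg_left (by exact_mod_cast min_le_right i m) Q.rate_pos.le

theorem existsUnique_isStationary (Q : IsQueue μ A m) (n : ℕ) :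
    ∃! π : Fin (m + n + 1) → ℝ, IsStationary μ A m n π := by
  refine existsUnique_stationary (transition_nonneg Q n) (fun i => ?_) fun i => ?_
  · have := sum_mul_transition Q n (fun _ => 1) i
    simp only [mul_one] at this
    rw [this]
    simp [deathMean, sum_deathProb]
  · have hi : min ((i.castSucc : ℕ) + 1) (m + n) = (i.succ : ℕ) := by
      have := i.2
      simp only [Fin.val_castSucc, Fin.val_succ]
      omega
    have := departProb_zero_le Q (i.succ : ℕ)
    refine (Q.departProb_pos 0).trans_le (this.trans (le_of_eq ?_))
    rw [transition, Matrix.of_apply, hi]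

lemma IsStationary.exists_seq (Q : IsQueue μ A m) {n : ℕ} {π : Fin (m + n + 1) → ℝ}
    (hπ : IsStationary μ A m n π) :
    ∃ q, IsStationarySeq μ A m n q ∧ q (m + n) = π (Fin.last (m + n)) := by
  set q : ℕ → ℝ := fun i => if h : i < m + n + 1 then π ⟨i, h⟩ else 0 with hq
  have hqπ : ∀ i : Fin (m + n + 1), q i = π i := fun i => dif_pos i.2
  refine ⟨q, ⟨fun i => ?_, ?_, fun h => ?_⟩, hqπ (Fin.last _)⟩
  · simp only [hq]
    split_ifs
    · exact hπ.1.1 _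
    · exact le_rfl
  · rw [← Fin.sum_univ_eq_sum_range]
    simp only [hqπ]
    exact hπ.1.2
  · rw [← Fin.sum_univ_eq_sum_range (fun i => q i * h i), ← Fin.sum_univ_eq_sum_range
      (fun i => q i * ∫ x, deathMean μ m h (min (i + 1) (m + n)) x ∂A)]
    simp only [hqπ, ← sum_mul_transition Q]
    calc ∑ j, π j * h j = ∑ j, (∑ i, π i * transition μ A m n i j) * h j := by
          refine Finset.sum_congr rfl fun j _ => ?_
          rw [show ∑ i, π i * transition μ A m n i j = π j from congrFun hπ.2 j]
      _ = _ := by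
          simp only [Finset.sum_mul, Finset.mul_sum, mul_assoc]
          exact Finset.sum_comm

/-- Above level `m`, upper sets are left through Poisson departures. -/
lemma integral_deathMean_indicator (Q : IsQueue μ A m) {j : ℕ} (hj : m ≤ j) (s : ℕ) :
    ∫ x, deathMean μ m (fun i => if j ≤ i then 1 else 0) s x ∂A =
      if j ≤ s then 1 - departTail μ A m (s - j) else 0 := by
  split_ifs with h
  · obtain ⟨e, rfl⟩ := Nat.exists_eq_add_of_le h
    have h1 : ∀ x, deathMean μ m (fun i => if j ≤ i then 1 else 0) (j + e) x =
        ∑ d ∈ Finset.range (e + 1),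
          Real.exp (-(μ * m * x)) * (μ * m * x) ^ d / d.factorial := by
      intro x
      rw [deathMean, add_assoc, Finset.sum_range_add, Finset.sum_eq_zero, zero_add,
        ← Finset.sum_range_reflect]
      · refine Finset.sum_congr rfl fun d hd => ?_
        have hd' := Finset.mem_range.1 hd
        rw [if_pos (by omega), one_mul, ← deathProb_poisson μ (j := j + (e + 1 - 1 - d)) (by omega)]
        congr 1
        omega
      · intro i hi
        rw [if_neg (by have := Finset.mem_range.1 hi; omega), zero_mul]
    simp only [h1]
    rw [integral_finsetSum _ fun d _ => integrable_departProb Q.nonneg Q.rate_pos d]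
    simp [departTail, tail, departProb]
  · have h1 : ∀ x, deathMean μ m (fun i => if j ≤ i then 1 else 0) s x = 0 := by
      intro x
      refine Finset.sum_eq_zero fun i hi => ?_
      beta_reduce
      rw [if_neg (by have := Finset.mem_range.1 hi; omega), zero_mul]
    simp [h1]

/-- The solution of the renewal equation `u = f * u + g`. -/
noncomputable def renewalSeq (f g : ℕ → ℝ) (k : ℕ) : ℝ :=
  (∑ l : Fin k, f (k - l) * renewalSeq f g l + g k) / (1 - f 0)
termination_by k
decreasing_by exact l.2

lemma isRenewal_renewalSeq {f g : ℕ → ℝ} (hf0 : f 0 ≠ 1) : IsRenewal f g (renewalSeq f g) := by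
  intro k
  have h0 : 1 - f 0 ≠ 0 := sub_ne_zero.2 hf0.symm
  have h1 : renewalSeq f g k * (1 - f 0) =
      ∑ l ∈ Finset.range k, f (k - l) * renewalSeq f g l + g k := by
    rw [renewalSeq, div_mul_cancel₀ _ h0,
      Fin.sum_univ_eq_sum_range (fun l => f (k - l) * renewalSeq f g l)]
  rw [Finset.sum_range_succ', ← Finset.sum_range_reflect]
  have h2 : ∑ l ∈ Finset.range k, f (k - 1 - l + 1) * renewalSeq f g (k - (k - 1 - l + 1)) =
      ∑ l ∈ Finset.range k, f (k - l) * renewalSeq f g l := by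
    refine Finset.sum_congr rfl fun l hl => ?_
    have := Finset.mem_range.1 hl
    rw [show k - 1 - l + 1 = k - l by omega, show k - (k - l) = l by omega]
  rw [h2, Nat.sub_zero]
  linarith

/-- The ratio of the stationary probabilities of the states `m + n - k` and `m + n`, for
`k ≤ n + 1`; it does not depend on `n`. -/
noncomputable def stateRatio (μ : ℝ) (A : Measure ℝ) (m : ℕ) : ℕ → ℝ :=
  renewalSeq (departTail μ A m) (departProb μ A m)

lemma isRenewal_stateRatio (Q : IsQueue μ A m) :
    IsRenewal (departTail μ A m) (departProb μ A m) (stateRatio μ A m) :=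
  isRenewal_renewalSeq Q.departTail_zero_lt_one.ne

lemma stateRatio_nonneg (Q : IsQueue μ A m) (k : ℕ) : 0 ≤ stateRatio μ A m k :=
  (isRenewal_stateRatio Q).nonneg Q.departTail_nonneg (fun k => (Q.departProb_pos k).le)
    Q.departTail_zero_lt_one k

lemma stateRatio_zero (Q : IsQueue μ A m) : stateRatio μ A m 0 = 1 := by
  have h := isRenewal_stateRatio Q 0
  simp only [zero_add, Finset.range_one, Finset.sum_singleton] at h
  have := Q.departProb_pos 0
  have h2 : departProb μ A m 0 * (stateRatio μ A m 0 - 1) = 0 := by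
    simp only [Nat.sub_zero, IsQueue.departTail_zero] at h; linarith
  rcases mul_eq_zero.1 h2 with h3 | h3 <;> linarith

lemma stateRatio_pos (Q : IsQueue μ A m) (k : ℕ) : 0 < stateRatio μ A m k := by
  rw [isRenewal_stateRatio Q k]
  have : 0 ≤ ∑ l ∈ Finset.range (k + 1), departTail μ A m l * stateRatio μ A m (k - l) :=
    Finset.sum_nonneg fun l _ => mul_nonneg (Q.departTail_nonneg l) (stateRatio_nonneg Q _)
  linarith [Q.departProb_pos k]

namespace IsStationarySeq

variable {n : ℕ} {q : ℕ → ℝ}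

/-- The flow balance across a level above `m`. -/
lemma cut (Q : IsQueue μ A m) (hq : IsStationarySeq μ A m n q) {k : ℕ} (hk : k ≤ n) :
    q (m + n - (k + 1)) = ∑ l ∈ Finset.range (k + 2),
      departTail μ A m l * q (m + n - (k + 1 - l)) + departProb μ A m (k + 1) * q (m + n) := by
  have hm := Q.servers_pos
  have h := hq.balance fun i => if m + n - k ≤ i then 1 else 0
  simp only [integral_deathMean_indicator Q (by omega : m ≤ m + n - k)] at h
  -- reindex both sides by the distance `l` to the largest state
  rw [← Finset.sum_range_reflect, ← Finset.sum_range_reflect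
    (fun i => q i * if m + n - k ≤ min (i + 1) (m + n) then
      1 - departTail μ A m (min (i + 1) (m + n) - (m + n - k)) else 0)] at h
  have hL : ∑ l ∈ Finset.range (m + n + 1), (q (m + n + 1 - 1 - l) *
      if m + n - k ≤ m + n + 1 - 1 - l then (1 : ℝ) else 0) =
      ∑ l ∈ Finset.range (k + 1), q (m + n - l) := by
    rw [← Finset.sum_subset (Finset.range_mono (by omega : k + 1 ≤ m + n + 1))]
    · refine Finset.sum_congr rfl fun l hl => ?_
      have := Finset.mem_range.1 hl
      rw [if_pos (by omega), mul_one, Nat.add_sub_cancel]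
    · intro l hl hl2
      simp only [Finset.mem_range] at hl hl2
      rw [if_neg (by omega), mul_zero]
  have hR : ∑ l ∈ Finset.range (m + n + 1), (q (m + n + 1 - 1 - l) *
      if m + n - k ≤ min (m + n + 1 - 1 - l + 1) (m + n) then
        1 - departTail μ A m (min (m + n + 1 - 1 - l + 1) (m + n) - (m + n - k)) else 0) =
      ∑ l ∈ Finset.range (k + 1), q (m + n - (l + 1)) * (1 - departTail μ A m (k - l)) +
        q (m + n) * (1 - departTail μ A m k) := by
    rw [← Finset.sum_subset (Finset.range_mono (by omega : k + 2 ≤ m + n + 1)),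
      Finset.sum_range_succ']
    · congr 1
      · refine Finset.sum_congr rfl fun l hl => ?_
        have := Finset.mem_range.1 hl
        rw [if_pos (by omega), Nat.add_sub_cancel,
          show min (m + n - (l + 1) + 1) (m + n) - (m + n - k) = k - l by omega]
      · rw [if_pos (by omega), Nat.add_sub_cancel, Nat.sub_zero,
          show min (m + n + 1) (m + n) - (m + n - k) = k by omega]
    · intro l hl hl2
      simp only [Finset.mem_range] at hl hl2
      rw [if_neg (by omega), mul_zero]
  rw [hL, hR, Finset.sum_range_succ'] at h
  simp only [mul_sub, mul_one, Finset.sum_sub_distrib, Nat.sub_zero] at h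
  rw [Finset.sum_range_succ (fun l => q (m + n - (l + 1)))] at h
  have h3 : departTail μ A m (k + 1) = departTail μ A m k - departProb μ A m (k + 1) :=
    tail_succ _ _ _
  rw [Finset.sum_range_succ _ (k + 1), h3, Nat.sub_self, Nat.sub_zero,
    ← Finset.sum_range_reflect]
  have h4 : ∑ l ∈ Finset.range (k + 1), departTail μ A m (k + 1 - 1 - l) *
      q (m + n - (k + 1 - (k + 1 - 1 - l))) =
      ∑ l ∈ Finset.range (k + 1), q (m + n - (l + 1)) * departTail μ A m (k - l) := by
    refine Finset.sum_congr rfl fun l hl => ?_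
    have := Finset.mem_range.1 hl
    rw [mul_comm, Nat.add_sub_cancel, show k + 1 - (k - l) = l + 1 by omega]
  rw [h4]
  linarith

lemma eq_stateRatio_mul (Q : IsQueue μ A m) (hq : IsStationarySeq μ A m n q) {k : ℕ}
    (hk : k ≤ n + 1) : q (m + n - k) = stateRatio μ A m k * q (m + n) := by
  induction k using Nat.strong_induction_on with
  | _ k ih =>
    rcases k with _ | k
    · rw [stateRatio_zero Q, one_mul, Nat.sub_zero]
    · have h1 := hq.cut Q (k := k) (by omega)
      have h2 := isRenewal_stateRatio Q (k + 1)
      rw [Finset.sum_range_succ'] at h1 h2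
      have h3 : ∑ l ∈ Finset.range (k + 1),
          departTail μ A m (l + 1) * q (m + n - (k + 1 - (l + 1))) =
          (∑ l ∈ Finset.range (k + 1), departTail μ A m (l + 1) *
            stateRatio μ A m (k + 1 - (l + 1))) * q (m + n) := by
        rw [Finset.sum_mul]
        refine Finset.sum_congr rfl fun l hl => ?_
        rw [ih _ (by omega) (by omega), mul_assoc]
      rw [h3, Nat.sub_zero] at h1
      rw [Nat.sub_zero] at h2
      have h4 : (1 - departTail μ A m 0) *
          (q (m + n - (k + 1)) - stateRatio μ A m (k + 1) * q (m + n)) = 0 := by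
        linear_combination h1 - q (m + n) * h2
      rcases mul_eq_zero.1 h4 with h5 | h5
      · linarith [Q.departTail_zero_lt_one]
      · linarith

lemma departProb_zero_mul_le (Q : IsQueue μ A m) (hq : IsStationarySeq μ A m n q) {j : ℕ}
    (hj : j < m + n) : departProb μ A m 0 * q j ≤ q (j + 1) := by
  have h := hq.balance fun i => if i = j + 1 then 1 else 0
  simp only [mul_ite, mul_one, mul_zero] at h
  rw [Finset.sum_ite_eq', if_pos (Finset.mem_range.2 (by omega))] at h
  rw [h]
  have hnn : ∀ i ∈ Finset.range (m + n + 1), 0 ≤ q i *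
      ∫ x, deathMean μ m (fun i => if i = j + 1 then 1 else 0) (min (i + 1) (m + n)) x ∂A :=
    fun i _ => mul_nonneg (hq.nonneg i) (integral_nonneg_of_ae (by
      filter_upwards [ae_nonneg Q.nonneg] with x hx
      exact deathMean_nonneg Q.rate_pos m (fun i => by split_ifs <;> norm_num) _ hx))
  refine le_trans ?_ (Finset.single_le_sum hnn (Finset.mem_range.2 (by omega : j < m + n + 1)))
  rw [mul_comm, min_eq_left (by omega)]
  refine mul_le_mul_of_nonneg_left ((departProb_zero_le Q (j + 1)).trans (le_of_eq ?_)) (hq.nonneg j)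
  simp [deathMean]

lemma pow_mul_le (Q : IsQueue μ A m) (hq : IsStationarySeq μ A m n q) {j i : ℕ}
    (hj : j + i ≤ m + n) : departProb μ A m 0 ^ i * q j ≤ q (j + i) := by
  induction i with
  | zero => simp
  | succ i ih =>
    have h1 := hq.departProb_zero_mul_le Q (j := j + i) (by omega)
    have h2 := mul_le_mul_of_nonneg_left (ih (by omega)) (Q.departProb_pos 0).le
    rw [← add_assoc]
    calc _ = departProb μ A m 0 * (departProb μ A m 0 ^ i * q j) := by ring
      _ ≤ _ := h2.trans h1

lemma sum_eq (Q : IsQueue μ A m) (hq : IsStationarySeq μ A m n q) :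
    ∑ i ∈ Finset.range (m - 1), q i +
      (∑ k ∈ Finset.range (n + 2), stateRatio μ A m k) * q (m + n) = 1 := by
  have hm := Q.servers_pos
  rw [Finset.sum_mul, ← hq.sum_eq_one, show m + n + 1 = (m - 1) + (n + 2) by omega,
    Finset.sum_range_add q, ← Finset.sum_range_reflect (fun k => q (m - 1 + k))]
  congr 1
  refine Finset.sum_congr rfl fun k hk => ?_
  have := Finset.mem_range.1 hk
  rw [← hq.eq_stateRatio_mul Q (by omega)]
  congr 1
  omega

lemma last_pos (Q : IsQueue μ A m) (hq : IsStationarySeq μ A m n q) : 0 < q (m + n) := by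
  obtain ⟨i, hi, hne⟩ := Finset.exists_ne_zero_of_sum_ne_zero
    (hq.sum_eq_one.symm ▸ one_ne_zero : ∑ i ∈ Finset.range (m + n + 1), q i ≠ 0)
  have hi' := Finset.mem_range.1 hi
  have h := hq.pow_mul_le Q (j := i) (i := m + n - i) (by omega)
  rw [show i + (m + n - i) = m + n by omega] at h
  exact (mul_pos (pow_pos (Q.departProb_pos 0) _)
    (lt_of_le_of_ne (hq.nonneg i) hne.symm)).trans_le h

/-- The states below `m - 1` carry at most a constant multiple of the mass of the state `m - 1`. -/
lemma sum_lower_le (Q : IsQueue μ A m) (hq : IsStationarySeq μ A m n q) :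
    ∑ i ∈ Finset.range (m - 1), q i ≤
      m / departProb μ A m 0 ^ m * (stateRatio μ A m (n + 1) * q (m + n)) := by
  have hm := Q.servers_pos
  have ha := Q.departProb_pos 0
  have ha1 : departProb μ A m 0 ≤ 1 := le_hasSum Q.hasSum_departProb 0
    fun k _ => (Q.departProb_pos k).le
  rw [← hq.eq_stateRatio_mul Q le_rfl, show m + n - (n + 1) = m - 1 by omega]
  have h1 : ∀ i ∈ Finset.range (m - 1), q i ≤ q (m - 1) / departProb μ A m 0 ^ m := by
    intro i hi
    have hi' := Finset.mem_range.1 hi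
    rw [le_div_iff₀ (pow_pos ha m), mul_comm]
    have h2 := hq.pow_mul_le Q (j := i) (i := m - 1 - i) (by omega)
    rw [show i + (m - 1 - i) = m - 1 by omega] at h2
    refine le_trans (mul_le_mul_of_nonneg_right ?_ (hq.nonneg i)) h2
    exact pow_le_pow_of_le_one ha.le ha1 (by omega)
  refine (Finset.sum_le_sum h1).trans ?_
  rw [Finset.sum_const, Finset.card_range, nsmul_eq_mul, div_mul_eq_mul_div, mul_div_assoc]
  refine mul_le_mul_of_nonneg_right (by exact_mod_cast Nat.sub_le m 1) ?_
  exact div_nonneg (hq.nonneg _) (pow_pos ha m).le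

end IsStationarySeq

/-- The reciprocal loss probability is a partial sum of the state ratios, up to a correction that
comes from the states below `m - 1`. -/
lemma exists_inv_lossProb_eq (Q : IsQueue μ A m) {n : ℕ} {q : ℕ → ℝ}
    (hq : IsStationarySeq μ A m n q) :
    ∃ e, 0 ≤ e ∧ e ≤ m / departProb μ A m 0 ^ m * stateRatio μ A m (n + 1) ∧
      (q (m + n))⁻¹ = ∑ k ∈ Finset.range (n + 2), stateRatio μ A m k + e := by
  have h0 := hq.last_pos Q
  refine ⟨(∑ i ∈ Finset.range (m - 1), q i) / q (m + n),
    div_nonneg (Finset.sum_nonneg fun i _ => hq.nonneg i) h0.le, ?_, ?_⟩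
  · rw [div_le_iff₀ h0, mul_assoc]; exact hq.sum_lower_le Q
  · have := hq.sum_eq Q
    field_simp
    linarith

end Queue

/-! ### Asymptotics of the loss probability for load at least one -/

section Asymptotic

variable {μ : ℝ} {A : Measure ℝ} [IsProbabilityMeasure A] {m : ℕ}

lemma tendsto_lossProb_of_one_lt (Q : IsQueue μ A m) (hρ : 1 < load μ A m) {q : ℕ → ℕ → ℝ}
    (hq : ∀ n, IsStationarySeq μ A m n (q n)) :
    Tendsto (fun n => q n (m + n)) atTop (𝓝 ((load μ A m - 1) / load μ A m)) := by
  have hρ1 : (load μ A m)⁻¹ < 1 := inv_lt_one_of_one_lt₀ hρ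
  have hsum := (isRenewal_stateRatio Q).hasSum_of_lt_one Q.departTail_nonneg
    (fun k => (Q.departProb_pos k).le) Q.hasSum_departTail hρ1 Q.hasSum_departProb
  choose e he0 he1 heq using fun n => exists_inv_lossProb_eq Q (hq n)
  have he : Tendsto e atTop (𝓝 0) := by
    refine squeeze_zero he0 he1 ?_
    simpa using (hsum.summable.tendsto_atTop_zero.comp (tendsto_add_atTop_nat 1)).const_mul
      ((m : ℝ) / departProb μ A m 0 ^ m)
  have h1 : Tendsto (fun n => (q n (m + n))⁻¹) atTop (𝓝 (1 / (1 - (load μ A m)⁻¹))) := by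
    have := (hsum.tendsto_sum_nat.comp (tendsto_add_atTop_nat 2)).add he
    rw [add_zero] at this
    exact this.congr fun n => (heq n).symm
  have h2 := h1.inv₀ (by have : 0 < 1 - (load μ A m)⁻¹ := by linarith
                         positivity)
  simp only [inv_inv, one_div] at h2
  convert h2 using 2
  have := Q.load_pos
  field_simp

/-- In the critical case, the product of the partial sums of the state ratios and of the second
tails `c` is `k`, up to an error of at most `1` plus a multiple of the partial sum of `l * c l`. -/
lemma stateRatio_sum_bounds (Q : IsQueue μ A m) (hρ : load μ A m = 1) (k : ℕ) :
    (k : ℝ) ≤ (∑ i ∈ Finset.range (k + 1), stateRatio μ A m i) *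
        ∑ l ∈ Finset.range (k + 1), tail 1 (departTail μ A m) l ∧
      (∑ i ∈ Finset.range (k + 1), stateRatio μ A m i) *
        ∑ l ∈ Finset.range (k + 1), tail 1 (departTail μ A m) l ≤
        k + 1 + 1 / (1 - departTail μ A m 0) *
          ∑ l ∈ Finset.range (k + 1), l * tail 1 (departTail μ A m) l := by
  have hb : HasSum (departTail μ A m) 1 := by simpa [hρ] using Q.hasSum_departTail
  have ha := fun k => (Q.departProb_pos k).le
  have hM := (isRenewal_stateRatio Q).le_of_hasSum Q.departTail_nonneg ha hb
    Q.departTail_zero_lt_one Q.hasSum_departProb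
  have h := (isRenewal_stateRatio Q).sum_mul_tail_bounds Q.departTail_nonneg hb
    (stateRatio_nonneg Q) hM k
  have h1 : ∑ j ∈ Finset.range (k + 1), ∑ i ∈ Finset.range (j + 1), departProb μ A m i =
      k + 1 - ∑ j ∈ Finset.range (k + 1), departTail μ A m j := by
    simp [departTail, tail]
  have h2 : ∑ j ∈ Finset.range (k + 1), departTail μ A m j ≤ 1 :=
    sum_le_hasSum _ (fun j _ => Q.departTail_nonneg j) hb
  have h3 : 0 ≤ ∑ j ∈ Finset.range (k + 1), departTail μ A m j :=
    Finset.sum_nonneg fun j _ => Q.departTail_nonneg j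
  rw [h1] at h
  constructor <;> linarith [h.1, h.2]

lemma stateRatio_le (Q : IsQueue μ A m) (hρ : load μ A m = 1) (k : ℕ) :
    stateRatio μ A m k ≤ 1 / (1 - departTail μ A m 0) :=
  (isRenewal_stateRatio Q).le_of_hasSum Q.departTail_nonneg (fun k => (Q.departProb_pos k).le)
    (by simpa [hρ] using Q.hasSum_departTail) Q.departTail_zero_lt_one Q.hasSum_departProb k

lemma tail_departTail_nonneg (Q : IsQueue μ A m) (hρ : load μ A m = 1) (k : ℕ) :
    0 ≤ tail 1 (departTail μ A m) k :=
  tail_nonneg Q.departTail_nonneg (by simpa [hρ] using Q.hasSum_departTail) k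

lemma rhoMoment_two_pos (Q : IsQueue μ A m) (hρ : load μ A m = 1)
    (h2 : Integrable (fun x : ℝ => (μ * m * x) ^ 2) A) : 0 < rhoMoment μ A m 2 / 2 := by
  have h := le_hasSum (Q.hasSum_tail_departTail hρ h2) 0
    fun j _ => tail_departTail_nonneg Q hρ j
  rw [tail_zero] at h
  linarith [Q.departTail_zero_lt_one]

lemma tendsto_mul_lossProb (Q : IsQueue μ A m) (hρ : load μ A m = 1)
    (h2 : Integrable (fun x : ℝ => (μ * m * x) ^ 2) A) {q : ℕ → ℕ → ℝ}
    (hq : ∀ n, IsStationarySeq μ A m n (q n)) :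
    Tendsto (fun n : ℕ => (n : ℝ) * q n (m + n)) atTop (𝓝 (rhoMoment μ A m 2 / 2)) := by
  set κ := rhoMoment μ A m 2 / 2 with hκdef
  have hκ : 0 < κ := rhoMoment_two_pos Q hρ h2
  have hc := Q.hasSum_tail_departTail hρ h2
  set M := 1 / (1 - departTail μ A m 0) with hM
  set S : ℕ → ℝ := fun k => ∑ i ∈ Finset.range (k + 1), stateRatio μ A m i with hS
  set C : ℕ → ℝ := fun k => ∑ l ∈ Finset.range (k + 1), tail 1 (departTail μ A m) l with hC
  have hCκ : Tendsto C atTop (𝓝 κ) := hc.tendsto_sum_nat.comp (tendsto_add_atTop_nat 1)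
  have hinv : Tendsto (fun k : ℕ => (1 : ℝ) / k) atTop (𝓝 0) := tendsto_const_div_atTop_nhds_zero_nat 1
  have hSC : Tendsto (fun k : ℕ => S k * C k / k) atTop (𝓝 1) := by
    have hup := ((hinv.const_add 1).add ((tendsto_sum_mul_div_zero
      (tail_departTail_nonneg Q hρ) hc.summable).const_mul M))
    rw [mul_zero, add_zero, add_zero] at hup
    refine tendsto_of_tendsto_of_tendsto_of_le_of_le' tendsto_const_nhds hup ?_ ?_
    · filter_upwards [eventually_gt_atTop 0] with k hk
      have hk' : (0 : ℝ) < k := by exact_mod_cast hk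
      rw [le_div_iff₀ hk', one_mul]
      exact (stateRatio_sum_bounds Q hρ k).1
    · filter_upwards [eventually_gt_atTop 0] with k hk
      have hk' : (0 : ℝ) < k := by exact_mod_cast hk
      rw [div_le_iff₀ hk']
      refine (stateRatio_sum_bounds Q hρ k).2.trans (le_of_eq ?_)
      field_simp
      ring
  have hSk : Tendsto (fun k : ℕ => S k / k) atTop (𝓝 (1 / κ)) := by
    refine (hSC.div hCκ hκ.ne').congr' ?_
    filter_upwards [hCκ.eventually_const_lt hκ] with k hk
    simp only [Pi.div_apply]
    field_simp
  have hSn : Tendsto (fun n : ℕ => S (n + 1) / n) atTop (𝓝 (1 / κ)) := by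
    have h3 := (hSk.comp (tendsto_add_atTop_nat 1)).mul (hinv.const_add 1)
    rw [add_zero, mul_one] at h3
    refine h3.congr' ?_
    filter_upwards [eventually_gt_atTop 0] with n hn
    have hn' : (0 : ℝ) < n := by exact_mod_cast hn
    simp only [Function.comp_apply]
    push_cast
    field_simp
  choose e he0 he1 heq using fun n => exists_inv_lossProb_eq Q (hq n)
  have he : Tendsto (fun n : ℕ => e n / n) atTop (𝓝 0) := by
    refine squeeze_zero (fun n => div_nonneg (he0 n) (Nat.cast_nonneg n)) (fun n => ?_)
      (tendsto_const_div_atTop_nhds_zero_nat ((m : ℝ) / departProb μ A m 0 ^ m * M))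
    refine div_le_div_of_nonneg_right ((he1 n).trans ?_) (Nat.cast_nonneg n)
    exact mul_le_mul_of_nonneg_left (stateRatio_le Q hρ _)
      (div_nonneg (Nat.cast_nonneg m) (pow_nonneg (Q.departProb_pos 0).le m))
  have h4 := (hSn.add he).inv₀ (by positivity)
  rw [add_zero, one_div, inv_inv] at h4
  refine h4.congr fun n => ?_
  rw [← add_div, ← heq n, inv_div, div_inv_eq_mul]

lemma isBigO_lossProb_sub (Q : IsQueue μ A m) (hρ : load μ A m = 1)
    (h3 : Integrable (fun x : ℝ => (μ * m * x) ^ 3) A) {q : ℕ → ℕ → ℝ}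
    (hq : ∀ n, IsStationarySeq μ A m n (q n)) :
    (fun n : ℕ => q n (m + n) - rhoMoment μ A m 2 / (2 * n)) =O[atTop]
      (fun n : ℕ => Real.log n / (n : ℝ) ^ 2) := by
  have h2 : Integrable (fun x : ℝ => (μ * m * x) ^ 2) A := by
    refine ((integrable_const 1).add h3).mono' (Continuous.aestronglyMeasurable (by fun_prop)) ?_
    filter_upwards [ae_nonneg Q.nonneg] with x hx
    have hμ := Q.rate_pos
    have hy : 0 ≤ μ * m * x := by positivity
    rw [Real.norm_of_nonneg (by positivity)]
    simp only [Pi.add_apply]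
    nlinarith [mul_nonneg hy (sq_nonneg (μ * m * x - 1)), sq_nonneg (μ * m * x - 1)]
  set κ := rhoMoment μ A m 2 / 2 with hκdef
  have hκ : 0 < κ := rhoMoment_two_pos Q hρ h2
  have hc := Q.hasSum_tail_departTail hρ h2
  have hcnn := tail_departTail_nonneg Q hρ
  have hD := Q.summable_mul_tail_departTail hρ h3
  set D := ∑' k : ℕ, (k : ℝ) * tail 1 (departTail μ A m) k with hDdef
  have hkcnn : ∀ k : ℕ, 0 ≤ (k : ℝ) * tail 1 (departTail μ A m) k :=
    fun k => mul_nonneg (Nat.cast_nonneg k) (hcnn k)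
  have hM0 : 0 < 1 / (1 - departTail μ A m 0) := by
    have := Q.departTail_zero_lt_one
    exact one_div_pos.2 (by linarith)
  set M := 1 / (1 - departTail μ A m 0) with hM
  set S : ℕ → ℝ := fun k => ∑ i ∈ Finset.range (k + 1), stateRatio μ A m i with hS
  set C : ℕ → ℝ := fun k => ∑ l ∈ Finset.range (k + 1), tail 1 (departTail μ A m) l with hC
  have hCle : ∀ k, C k ≤ κ := fun k => sum_le_hasSum _ (fun j _ => hcnn j) hc
  have hCge : ∀ k : ℕ, (κ - C k) * (k + 1) ≤ D := by
    intro k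
    have e1 := ((hasSum_nat_add_iff' (k + 1)).2 hc).mul_right ((k : ℝ) + 1)
    have e2 := (hasSum_nat_add_iff' (k + 1)).2 hD.hasSum
    refine (hasSum_le (fun j => ?_) e1 e2).trans
      (sub_le_self _ (Finset.sum_nonneg fun j _ => hkcnn j))
    rw [mul_comm]
    refine mul_le_mul_of_nonneg_right ?_ (hcnn _)
    push_cast
    linarith [(Nat.cast_nonneg j : (0 : ℝ) ≤ j)]
  have hS0 : ∀ k, 0 ≤ S k := fun k => Finset.sum_nonneg fun i _ => stateRatio_nonneg Q i
  have hSle : ∀ k : ℕ, S k ≤ M * (k + 1) := fun k => by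
    refine (Finset.sum_le_sum fun i _ => stateRatio_le Q hρ i).trans (le_of_eq ?_)
    rw [Finset.sum_const, Finset.card_range, nsmul_eq_mul]
    push_cast; ring
  have hlow : ∀ k : ℕ, (k : ℝ) ≤ κ * S k := fun k =>
    (stateRatio_sum_bounds Q hρ k).1.trans (by
      rw [mul_comm κ]; exact mul_le_mul_of_nonneg_left (hCle k) (hS0 k))
  have hupp : ∀ k : ℕ, κ * S k ≤ k + 1 + 2 * M * D := fun k => by
    have e1 := (stateRatio_sum_bounds Q hρ k).2
    have e2 : ∑ l ∈ Finset.range (k + 1), (l : ℝ) * tail 1 (departTail μ A m) l ≤ D :=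
      hD.sum_le_tsum _ fun j _ => hkcnn j
    have e3 : S k * (κ - C k) ≤ M * D := by
      calc S k * (κ - C k) ≤ M * (k + 1) * (κ - C k) :=
            mul_le_mul_of_nonneg_right (hSle k) (sub_nonneg.2 (hCle k))
        _ = M * ((κ - C k) * (k + 1)) := by ring
        _ ≤ M * D := mul_le_mul_of_nonneg_left (hCge k) hM0.le
    have e4 := mul_le_mul_of_nonneg_left e2 hM0.le
    have e5 : κ * S k = S k * C k + S k * (κ - C k) := by ring
    rw [e5]
    linarith
  choose e he0 he1 heq using fun n => exists_inv_lossProb_eq Q (hq n)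
  -- with `I = 1 / p n`, the difference is `(n - κ I) / (n I)`; the numerator is bounded by `B`
  set E := (m : ℝ) / departProb μ A m 0 ^ m * M with hE
  have heE : ∀ n, e n ≤ E := fun n => (he1 n).trans
    (mul_le_mul_of_nonneg_left (stateRatio_le Q hρ _)
      (div_nonneg (Nat.cast_nonneg m) (pow_nonneg (Q.departProb_pos 0).le m)))
  set B := 2 + 2 * M * D + κ * E with hB
  refine IsBigO.of_bound (B * κ) ?_
  filter_upwards [eventually_ge_atTop 3] with n hn
  have hn' : (3 : ℝ) ≤ n := by exact_mod_cast hn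
  have hn0 : (0 : ℝ) < n := by linarith
  have hp : 0 < q n (m + n) := (hq n).last_pos Q
  set I := (q n (m + n))⁻¹ with hI
  have hI0 : 0 < I := inv_pos.2 hp
  have hIeq : I = S (n + 1) + e n := heq n
  have hl := hlow (n + 1)
  have hu := hupp (n + 1)
  push_cast at hl hu
  have hke : κ * e n ≤ κ * E := mul_le_mul_of_nonneg_left (heE n) hκ.le
  have hke0 : 0 ≤ κ * e n := mul_nonneg hκ.le (he0 n)
  have hIlow : (n : ℝ) ≤ κ * I := by rw [hIeq, mul_add]; linarith
  have hIup : κ * I - n ≤ B := by rw [hIeq, mul_add]; linarith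
  have hB0 : 0 ≤ B := by linarith
  have hlog : 1 ≤ Real.log n := by
    rw [Real.le_log_iff_exp_le hn0]
    exact Real.exp_one_lt_three.le.trans hn'
  have hdiff : q n (m + n) - rhoMoment μ A m 2 / (2 * n) = -((κ * I - n) / (n * I)) := by
    have : q n (m + n) = I⁻¹ := by rw [hI, inv_inv]
    rw [this, hκdef]
    field_simp
    ring
  rw [hdiff, norm_neg, Real.norm_of_nonneg (div_nonneg (by linarith) (by positivity)),
    Real.norm_of_nonneg (by positivity)]
  calc (κ * I - n) / (n * I) ≤ B / (n * I) := by gcongr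
    _ ≤ B / (n * (n / κ)) := by
        gcongr
        rw [div_le_iff₀ hκ]; linarith
    _ = B * κ * (1 / (n : ℝ) ^ 2) := by field_simp
    _ ≤ B * κ * (Real.log n / (n : ℝ) ^ 2) := by gcongr

end Asymptotic

/-! ### Binomial moments of the number of busy servers -/

section Binomial

variable {μ : ℝ} {A : Measure ℝ} {m : ℕ}

/-- The binomial coefficient `j.choose s`, cut off above level `m`. -/
def truncChoose (m s j : ℕ) : ℝ := if j ≤ m then j.choose s else 0

/-- The expected value of `truncChoose m s` at the end of an interarrival time that starts with
`m + k` customers. -/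
noncomputable def busyMoment (μ : ℝ) (A : Measure ℝ) (m s k : ℕ) : ℝ :=
  ∫ x, deathMean μ m (truncChoose m s) (m + k) x ∂A

lemma truncChoose_nonneg (m s j : ℕ) : 0 ≤ truncChoose m s j := by
  unfold truncChoose; split_ifs <;> positivity

lemma truncChoose_le (m s j : ℕ) : truncChoose m s j ≤ m.choose s := by
  unfold truncChoose
  split_ifs with h
  · exact_mod_cast Nat.choose_le_choose s h
  · positivity

lemma busyMoment_nonneg (Q : IsQueue μ A m) (s k : ℕ) : 0 ≤ busyMoment μ A m s k :=
  integral_nonneg_of_ae (by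
    filter_upwards [ae_nonneg Q.nonneg] with x hx
    exact deathMean_nonneg Q.rate_pos m (truncChoose_nonneg m s) _ hx)

/-- The stationarity equation for the test function `truncChoose m (s + 1)`. Pascal's rule accounts
for the arriving customer. -/
lemma IsStationarySeq.binomial {n : ℕ} {q : ℕ → ℝ}
    (hq : IsStationarySeq μ A m n q) (s : ℕ) :
    ∑ i ∈ Finset.range m, q i * i.choose (s + 1) + q m * m.choose (s + 1) =
      phi μ A (s + 1) * (∑ i ∈ Finset.range m, q i * i.choose (s + 1) +
        ∑ i ∈ Finset.range m, q i * i.choose s) +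
      ∑ k ∈ Finset.range (n + 1), q (m + k) * busyMoment μ A m (s + 1) (min (k + 1) n) := by
  have h := hq.balance (truncChoose m (s + 1))
  rw [add_assoc m n 1, Finset.sum_range_add, Finset.sum_range_add _ m] at h
  have h1 : ∑ i ∈ Finset.range m, q i * truncChoose m (s + 1) i =
      ∑ i ∈ Finset.range m, q i * i.choose (s + 1) := by
    refine Finset.sum_congr rfl fun i hi => ?_
    rw [truncChoose, if_pos (Finset.mem_range.1 hi).le]
  have h2 : ∑ k ∈ Finset.range (n + 1), q (m + k) * truncChoose m (s + 1) (m + k) =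
      q m * m.choose (s + 1) := by
    rw [Finset.sum_range_succ', Finset.sum_eq_zero, zero_add]
    · simp [truncChoose]
    · intro k _
      rw [truncChoose, if_neg (by omega), mul_zero]
  have h3 : ∑ i ∈ Finset.range m, (q i *
      ∫ x, deathMean μ m (truncChoose m (s + 1)) (min (i + 1) (m + n)) x ∂A) =
      phi μ A (s + 1) * (∑ i ∈ Finset.range m, q i * i.choose (s + 1) +
        ∑ i ∈ Finset.range m, q i * i.choose s) := by
    rw [← Finset.sum_add_distrib, Finset.mul_sum]
    refine Finset.sum_congr rfl fun i hi => ?_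
    have hi' := Finset.mem_range.1 hi
    have e : ∀ x, deathMean μ m (truncChoose m (s + 1)) (min (i + 1) (m + n)) x =
        (i + 1).choose (s + 1) * Real.exp (-(μ * (s + 1 : ℕ) * x)) := by
      intro x
      rw [min_eq_left (by omega)]
      exact deathMean_choose μ m (s + 1) (fun j hj => if_pos hj) (by omega) x
    simp only [e]
    rw [integral_const_mul, Nat.choose_succ_succ, phi, lst]
    push_cast
    ring
  have h4 : ∑ k ∈ Finset.range (n + 1), (q (m + k) *
      ∫ x, deathMean μ m (truncChoose m (s + 1)) (min (m + k + 1) (m + n)) x ∂A) =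
      ∑ k ∈ Finset.range (n + 1), q (m + k) * busyMoment μ A m (s + 1) (min (k + 1) n) := by
    refine Finset.sum_congr rfl fun k _ => ?_
    rw [busyMoment, add_assoc, Nat.add_min_add_left]
  rw [h1, h2, h3, h4] at h
  exact h

variable [IsProbabilityMeasure A]

lemma busyMoment_le (Q : IsQueue μ A m) (s k : ℕ) : busyMoment μ A m s k ≤ m.choose s := by
  have h := integral_mono_ae (integrable_deathMean Q (truncChoose m s) (m + k))
    (integrable_const (m.choose s : ℝ)) (by
      filter_upwards [ae_nonneg Q.nonneg] with x hx
      exact deathMean_le Q.rate_pos m (truncChoose_le m s) _ hx)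
  simpa [busyMoment] using h

/-- The partial sums of the generating function in `k` of the expectations of `truncChoose m s`,
for the death process started at `m + k`, with an error bound. The sum `W` over all `k ≥ 1` would
solve `W' = -β W + μ m σ G₀`, where `β = μ m (1 - σ)` and `G₀` is the expectation for `k = 0`; its
solution is the closed form in the statement. The error `E` of the `K`-th partial sum satisfies
`E' = -β E + μ m σ ^ (K + 1) G_K`, with `0 ≤ G_K ≤ m.choose s`, and is bounded by comparison. -/
lemma truncChoose_gen_bounds (hμ : 0 < μ) (m s : ℕ) {σ : ℝ} (hσ0 : 0 < σ) (hσ1 : σ < 1)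
    (hne : (m : ℝ) * (1 - σ) - s ≠ 0) (K : ℕ) {x : ℝ} (hx : 0 ≤ x) :
    0 ≤ m.choose s * (m * σ) / (m * (1 - σ) - s) *
        (Real.exp (-(μ * s * x)) - Real.exp (-((μ * m - μ * m * σ) * x))) -
        ∑ k ∈ Finset.range K, σ ^ (k + 1) * deathMean μ m (truncChoose m s) (m + (k + 1)) x ∧
      m.choose s * (m * σ) / (m * (1 - σ) - s) *
        (Real.exp (-(μ * s * x)) - Real.exp (-((μ * m - μ * m * σ) * x))) -
        ∑ k ∈ Finset.range K, σ ^ (k + 1) * deathMean μ m (truncChoose m s) (m + (k + 1)) x ≤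
      μ * m * σ ^ (K + 1) * m.choose s * x := by
  set G : ℕ → ℝ → ℝ := fun k => deathMean μ m (truncChoose m s) (m + k) with hG
  set β := μ * m - μ * m * σ with hβ
  set c := m.choose s * (m * σ) / (m * (1 - σ) - s) with hc
  set W : ℕ → ℝ → ℝ := fun K x => ∑ k ∈ Finset.range K, σ ^ (k + 1) * G (k + 1) x with hW
  set E : ℝ → ℝ := fun x => c * (Real.exp (-(μ * s * x)) - Real.exp (-(β * x))) - W K x with hE
  have hmμ : 0 ≤ μ * m := by positivity
  have hβ0 : 0 ≤ β := by rw [hβ]; nlinarith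
  have hG0 : ∀ x, G 0 x = m.choose s * Real.exp (-(μ * s * x)) := fun x =>
    deathMean_choose μ m s (fun j hj => if_pos hj) le_rfl x
  have hGd : ∀ k x, HasDerivAt (G (k + 1)) (μ * m * (G k x - G (k + 1) x)) x := fun k x => by
    have := hasDerivAt_deathMean μ m (truncChoose m s) (m + k) x
    rwa [rate_of_ge μ (by omega)] at this
  have hGle : ∀ k x, 0 ≤ x → G k x ≤ m.choose s := fun k x hx =>
    deathMean_le hμ m (truncChoose_le m s) _ hx
  have hGnn : ∀ k x, 0 ≤ x → 0 ≤ G k x := fun k x hx =>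
    deathMean_nonneg hμ m (truncChoose_nonneg m s) _ hx
  have hWd : ∀ K x, HasDerivAt (W K)
      (-β * W K x + μ * m * σ * G 0 x - μ * m * σ ^ (K + 1) * G K x) x := by
    intro K x
    refine (HasDerivAt.fun_sum fun k _ => (hGd k x).const_mul (σ ^ (k + 1))).congr_deriv ?_
    induction K with
    | zero => simp [hW]
    | succ K ih =>
      rw [Finset.sum_range_succ, ih]
      simp only [hW, Finset.sum_range_succ, hβ]
      ring
  have hcβ : c * (β - μ * s) = μ * m * σ * m.choose s := by
    rw [hc, hβ]; field_simp
  have hEd : ∀ x, HasDerivAt E (μ * m * σ ^ (K + 1) * G K x - β * E x) x := by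
    intro x
    refine ((((hasDerivAt_exp_neg_mul (μ * s) x).fun_sub
      (hasDerivAt_exp_neg_mul β x)).const_mul c).fun_sub (hWd K x)).congr_deriv ?_
    rw [hG0]
    simp only [hE]
    linear_combination Real.exp (-(μ * s * x)) * hcβ
  have hE0 : E 0 = 0 := by
    have : ∀ k, G (k + 1) 0 = 0 := fun k => by
      simp only [hG]
      rw [deathMean_zero, truncChoose, if_neg (by omega)]
    simp [hE, hW, this]
  constructor
  · exact nonneg_of_hasDerivAt (fun x hx => mul_nonneg (by positivity) (hGnn K x hx)) hEd hE0.ge hx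
  · have h := nonneg_of_hasDerivAt (c := β)
      (y := fun x => μ * m * σ ^ (K + 1) * m.choose s * x - E x)
      (s := fun x => μ * m * σ ^ (K + 1) * (m.choose s - G K x) +
        β * (μ * m * σ ^ (K + 1) * m.choose s * x))
      (fun x hx => add_nonneg (mul_nonneg (by positivity) (sub_nonneg.2 (hGle K x hx)))
        (by positivity))
      (fun x => by
        refine (((hasDerivAt_id x).const_mul (μ * m * σ ^ (K + 1) * m.choose s)).fun_sub
          (hEd x)).congr_deriv ?_
        simp only [mul_one]
        ring)
      (by simp [hE0]) hx
    exact sub_nonneg.1 h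

lemma hasSum_busyMoment (Q : IsQueue μ A m) (s : ℕ) {σ : ℝ}
    (hσ : σ = lst A (μ * m - μ * m * σ)) (hσ0 : 0 < σ) (hσ1 : σ < 1)
    (hne : (m : ℝ) * (1 - σ) - s ≠ 0) :
    HasSum (fun k => σ ^ (k + 1) * busyMoment μ A m s (k + 1))
      (m.choose s * (m * σ) / (m * (1 - σ) - s) * (phi μ A s - σ)) := by
  have hμ := Q.rate_pos
  set c := m.choose s * (m * σ) / (m * (1 - σ) - s) with hc
  have hβ0 : 0 ≤ μ * m - μ * m * σ := by
    have : 0 ≤ μ * m := by positivity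
    nlinarith
  have hi1 := integrable_exp_neg Q.nonneg (s := μ * s) (by positivity)
  have hi2 := integrable_exp_neg Q.nonneg hβ0
  rw [hasSum_iff_tendsto_nat_of_nonneg
    (fun k => mul_nonneg (pow_nonneg hσ0.le _) (busyMoment_nonneg Q s _))]
  have hint : ∀ K, c * (phi μ A s - σ) -
      ∑ k ∈ Finset.range K, σ ^ (k + 1) * busyMoment μ A m s (k + 1) =
      ∫ x, (c * (Real.exp (-(μ * s * x)) - Real.exp (-((μ * m - μ * m * σ) * x))) -
        ∑ k ∈ Finset.range K, σ ^ (k + 1) *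
          deathMean μ m (truncChoose m s) (m + (k + 1)) x) ∂A := by
    intro K
    rw [integral_sub (f := fun x => c * (Real.exp (-(μ * s * x)) -
        Real.exp (-((μ * m - μ * m * σ) * x)))) ((hi1.sub hi2).const_mul c)
      (integrable_finsetSum _ fun k _ => (integrable_deathMean Q _ _).const_mul _),
      integral_const_mul, integral_sub hi1 hi2,
      integral_finsetSum _ fun k _ => (integrable_deathMean Q _ _).const_mul _]
    simp only [integral_const_mul, busyMoment]
    congr 2
    rw [phi, lst]
    congr 1
  have hint2 : ∀ K, Integrable (fun x => c * (Real.exp (-(μ * s * x)) -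
      Real.exp (-((μ * m - μ * m * σ) * x))) - ∑ k ∈ Finset.range K, σ ^ (k + 1) *
          deathMean μ m (truncChoose m s) (m + (k + 1)) x) A := fun K =>
    ((hi1.sub hi2).const_mul c).sub
      (integrable_finsetSum _ fun k _ => (integrable_deathMean Q _ _).const_mul _)
  have hlim : Tendsto (fun K => c * (phi μ A s - σ) -
      ∑ k ∈ Finset.range K, σ ^ (k + 1) * busyMoment μ A m s (k + 1)) atTop (𝓝 0) := by
    have hup : Tendsto (fun K : ℕ => μ * m * σ ^ (K + 1) * m.choose s * ∫ x, x ∂A) atTop (𝓝 0) := by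
      have := (((tendsto_pow_atTop_nhds_zero_of_lt_one hσ0.le hσ1).comp
        (tendsto_add_atTop_nat 1)).const_mul (μ * m)).mul_const ((m.choose s : ℝ) * ∫ x, x ∂A)
      rw [mul_zero, zero_mul] at this
      refine this.congr fun K => ?_
      simp only [Function.comp_apply]
      ring
    refine squeeze_zero (fun K => ?_) (fun K => ?_) hup
    · rw [hint]
      refine integral_nonneg_of_ae ?_
      filter_upwards [ae_nonneg Q.nonneg] with x hx
      exact (truncChoose_gen_bounds hμ m s hσ0 hσ1 hne K hx).1
    · rw [hint, ← integral_const_mul]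
      refine integral_mono_ae (hint2 K) (Q.integrable.const_mul _) ?_
      filter_upwards [ae_nonneg Q.nonneg] with x hx
      exact (truncChoose_gen_bounds hμ m s hσ0 hσ1 hne K hx).2
  have := (tendsto_const_nhds (x := c * (phi μ A s - σ))).sub hlim
  simpa using this

lemma phi_pos (Q : IsQueue μ A m) (j : ℕ) : 0 < phi μ A j :=
  lst_pos Q.nonneg (mul_nonneg Q.rate_pos.le (Nat.cast_nonneg j))

lemma phi_succ_lt_one (Q : IsQueue μ A m) (j : ℕ) : phi μ A (j + 1) < 1 :=
  lst_lt_one Q.nonneg Q.mean_pos (mul_pos Q.rate_pos (by positivity))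

lemma coeffC_succ (μ : ℝ) (A : Measure ℝ) (j : ℕ) :
    coeffC μ A (j + 1) = coeffC μ A j * ((1 - phi μ A (j + 1)) / phi μ A (j + 1)) := by
  rw [coeffC, Finset.prod_Icc_succ_top (by omega), coeffC]

/-- Solution of the recursion for the binomial moments of the number of busy servers, which gives
the mass of the states below `m`. -/
lemma IsStationarySeq.sum_lower_eq (Q : IsQueue μ A m) {n : ℕ} {q : ℕ → ℝ}
    (hq : IsStationarySeq μ A m n q) :
    ∑ i ∈ Finset.range m, q i = ∑ s ∈ Finset.range m,
      coeffC μ A (s + 1) / (1 - phi μ A (s + 1)) * (q m * m.choose (s + 1) -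
        ∑ k ∈ Finset.range (n + 1), q (m + k) * busyMoment μ A m (s + 1) (min (k + 1) n)) := by
  have key : ∀ J : ℕ, coeffC μ A J * ∑ i ∈ Finset.range m, q i * i.choose J =
      ∑ i ∈ Finset.range m, q i - ∑ s ∈ Finset.range J,
        coeffC μ A (s + 1) / (1 - phi μ A (s + 1)) * (q m * m.choose (s + 1) -
        ∑ k ∈ Finset.range (n + 1), q (m + k) * busyMoment μ A m (s + 1) (min (k + 1) n)) := by
    intro J
    induction J with
    | zero => simp [coeffC]
    | succ J ih =>
      rw [Finset.sum_range_succ, ← sub_sub, ← ih, coeffC_succ]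
      have h := hq.binomial J
      have h1 := (phi_pos Q (J + 1)).ne'
      have h2 : 1 - phi μ A (J + 1) ≠ 0 := by linarith [phi_succ_lt_one Q J]
      field_simp
      linear_combination coeffC μ A J * h
  have h := key m
  have h0 : ∑ i ∈ Finset.range m, q i * (i.choose m : ℝ) = 0 :=
    Finset.sum_eq_zero fun i hi => by
      rw [Nat.choose_eq_zero_of_lt (Finset.mem_range.1 hi)]; simp
  rw [h0, mul_zero] at h
  linarith

end Binomial

/-! ### Asymptotics of the loss probability for load below one -/

section Subcritical

variable {μ : ℝ} {A : Measure ℝ} [IsProbabilityMeasure A] {m : ℕ}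

lemma hasSum_tilted (Q : IsQueue μ A m) {σ : ℝ} (hσ : σ = lst A (μ * m - μ * m * σ))
    (hσ0 : 0 < σ) (hσ1 : σ < 1) : HasSum (fun k => departTail μ A m k * σ ^ k) 1 := by
  have := Q.hasSum_departTail_pow hσ0.le hσ1
  rwa [← hσ, div_self (by linarith)] at this

/-- Tilting by `σ` turns the excessive renewal equation of the state ratios into a proper one. -/
lemma isRenewal_tilted (Q : IsQueue μ A m) (σ : ℝ) :
    IsRenewal (fun k => departTail μ A m k * σ ^ k) (fun k => departProb μ A m k * σ ^ k)
      (fun k => stateRatio μ A m k * σ ^ k) := by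
  intro k
  beta_reduce
  rw [isRenewal_stateRatio Q k, add_mul, Finset.sum_mul]
  congr 1
  refine Finset.sum_congr rfl fun l hl => ?_
  have := Finset.mem_range.1 hl
  rw [show σ ^ k = σ ^ l * σ ^ (k - l) by rw [← pow_add]; congr 1; omega]
  ring

lemma one_add_deriv_pos (Q : IsQueue μ A m) {σ : ℝ} (hσ : σ = lst A (μ * m - μ * m * σ))
    (hσ0 : 0 < σ) (hσ1 : σ < 1) : 0 < 1 + μ * m * deriv (lst A) (μ * m - μ * m * σ) := by
  have hnn : ∀ k, 0 ≤ departTail μ A m k * σ ^ k := fun k =>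
    mul_nonneg (Q.departTail_nonneg k) (pow_nonneg hσ0.le k)
  have h := le_hasSum (Q.hasSum_tail_tilted hσ hσ0 hσ1) 0
    fun j _ => tail_nonneg hnn (hasSum_tilted Q hσ hσ0 hσ1) j
  rw [tail_zero] at h
  have h1 : 0 < σ * (1 + μ * m * deriv (lst A) (μ * m - μ * m * σ)) / (1 - σ) := by
    refine lt_of_lt_of_le ?_ h
    have := Q.departTail_zero_lt_one
    simp only [pow_zero, mul_one]
    linarith
  rw [div_pos_iff_of_pos_right (by linarith)] at h1
  exact (mul_pos_iff_of_pos_left hσ0).1 h1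

lemma exists_tilted_le (Q : IsQueue μ A m) {σ : ℝ} (hσ : σ = lst A (μ * m - μ * m * σ))
    (hσ0 : 0 < σ) (hσ1 : σ < 1) : ∃ M, ∀ k, stateRatio μ A m k * σ ^ k ≤ M := by
  have h0 := hasSum_departProb_lst (m := m) Q.nonneg Q.rate_pos hσ0.le hσ1.le
  refine ⟨_, (isRenewal_tilted Q σ).le_of_hasSum
    (fun k => mul_nonneg (Q.departTail_nonneg k) (pow_nonneg hσ0.le k))
    (fun k => mul_nonneg (Q.departProb_pos k).le (pow_nonneg hσ0.le k))
    (hasSum_tilted Q hσ hσ0 hσ1) ?_ h0⟩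
  simpa using Q.departTail_zero_lt_one

lemma tendsto_tilted (Q : IsQueue μ A m) {σ : ℝ} (hσ : σ = lst A (μ * m - μ * m * σ))
    (hσ0 : 0 < σ) (hσ1 : σ < 1) : Tendsto (fun k => stateRatio μ A m k * σ ^ k) atTop
      (𝓝 ((1 - σ) / (1 + μ * m * deriv (lst A) (μ * m - μ * m * σ)))) := by
  have h0 := hasSum_departProb_lst (m := m) Q.nonneg Q.rate_pos hσ0.le hσ1.le
  rw [← hσ] at h0
  obtain ⟨M, hM⟩ := exists_tilted_le Q hσ hσ0 hσ1
  have hpos := one_add_deriv_pos Q hσ hσ0 hσ1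
  have h1σ : 0 < 1 - σ := by linarith
  have h := (isRenewal_tilted Q σ).tendsto_div
    (fun k => mul_nonneg (Q.departTail_nonneg k) (pow_nonneg hσ0.le k))
    (hasSum_tilted Q hσ hσ0 hσ1) (mul_pos (Q.departTail_pos 1) (pow_pos hσ0 1)) h0
    (Q.hasSum_tail_tilted hσ hσ0 hσ1) (by positivity) (M := M) (fun k => by
      rw [abs_of_nonneg (mul_nonneg (stateRatio_nonneg Q k) (pow_nonneg hσ0.le k))]
      exact hM k)
  convert h using 2
  field_simp

/-- Averages over the states `m, …, m + n`, relative to the state `m - 1`, converge to averages over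
a geometric sequence. -/
lemma tendsto_sum_ratio_mul (Q : IsQueue μ A m) {σ : ℝ} (hσ : σ = lst A (μ * m - μ * m * σ))
    (hσ0 : 0 < σ) (hσ1 : σ < 1) {γ : ℕ → ℝ} {B : ℝ} (hγ : ∀ k, |γ k| ≤ B) :
    Tendsto (fun n => ∑ k ∈ Finset.range (n + 1),
      stateRatio μ A m (n - k) / stateRatio μ A m (n + 1) * γ (min (k + 1) n)) atTop
      (𝓝 (∑' k, σ ^ (k + 1) * γ (k + 1))) := by
  obtain ⟨M, hM⟩ := exists_tilted_le Q hσ hσ0 hσ1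
  have hlim := tendsto_tilted Q hσ hσ0 hσ1
  have hpos := one_add_deriv_pos Q hσ hσ0 hσ1
  set ℓ := (1 - σ) / (1 + μ * m * deriv (lst A) (μ * m - μ * m * σ)) with hℓ
  have hℓ0 : 0 < ℓ := div_pos (by linarith) hpos
  set u : ℕ → ℝ := fun k => stateRatio μ A m k * σ ^ k with hu
  have hupos : ∀ k, 0 < u k := fun k => mul_pos (stateRatio_pos Q k) (pow_pos hσ0 k)
  have hratio : ∀ n k, k ≤ n → stateRatio μ A m (n - k) / stateRatio μ A m (n + 1) =
      σ ^ (k + 1) * (u (n - k) / u (n + 1)) := by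
    intro n k hk
    have h1 := (stateRatio_pos Q (n + 1)).ne'
    have h2 := (stateRatio_pos Q (n - k)).ne'
    simp only [hu]
    rw [show σ ^ (n + 1) = σ ^ (n - k) * σ ^ (k + 1) by rw [← pow_add]; congr 1; omega]
    field_simp
  have hsum : ∀ n, ∑ k ∈ Finset.range (n + 1),
      stateRatio μ A m (n - k) / stateRatio μ A m (n + 1) * γ (min (k + 1) n) =
      ∑' k, if k ≤ n then σ ^ (k + 1) * (u (n - k) / u (n + 1)) * γ (min (k + 1) n) else 0 := by
    intro n
    rw [tsum_eq_sum (s := Finset.range (n + 1))]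
    · refine Finset.sum_congr rfl fun k hk => ?_
      have hk' : k ≤ n := by have := Finset.mem_range.1 hk; omega
      rw [if_pos hk', hratio n k hk']
    · intro k hk
      rw [if_neg (by simpa using hk)]
  simp only [hsum]
  have hB : 0 ≤ B := (abs_nonneg _).trans (hγ 0)
  have hM0 : 0 ≤ M := (hupos 0).le.trans (hM 0)
  refine tendsto_tsum_of_dominated_convergence
    (bound := fun k => σ ^ k * (M / (ℓ / 2) * B)) ?_ (fun k => ?_) ?_
  · exact (summable_geometric_of_lt_one hσ0.le hσ1).mul_right _
  · have h1 : Tendsto (fun n => u (n - k) / u (n + 1)) atTop (𝓝 1) := by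
      have := (hlim.comp (tendsto_sub_atTop_nat k)).div (hlim.comp (tendsto_add_atTop_nat 1)) hℓ0.ne'
      rwa [div_self hℓ0.ne'] at this
    have h2 := (h1.const_mul (σ ^ (k + 1))).mul_const (γ (k + 1))
    rw [mul_one] at h2
    refine h2.congr' ?_
    filter_upwards [eventually_ge_atTop (k + 1)] with n hn
    rw [if_pos (by omega), min_eq_left hn]
  · filter_upwards [(hlim.comp (tendsto_add_atTop_nat 1)).eventually_const_lt
      (half_lt_self hℓ0)] with n hn k
    simp only [Function.comp_apply] at hn
    split_ifs with hk
    · rw [Real.norm_eq_abs, abs_mul, abs_of_nonneg (by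
        have := hupos (n - k); have := hupos (n + 1); positivity), mul_assoc]
      have e1 : σ ^ (k + 1) ≤ σ ^ k := pow_le_pow_of_le_one hσ0.le hσ1.le (Nat.le_succ k)
      have e2 : u (n - k) / u (n + 1) ≤ M / (ℓ / 2) := div_le_div₀ hM0 (hM _) (by positivity) hn.le
      have e3 : 0 ≤ u (n - k) / u (n + 1) := div_nonneg (hupos _).le (hupos _).le
      exact mul_le_mul e1 (mul_le_mul e2 (hγ _) (abs_nonneg _) (by positivity)) (by positivity)
        (by positivity)
    · rw [norm_zero]; positivity

theorem tendsto_lossProb_div_pow (Q : IsQueue μ A m) {σ : ℝ}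
    (hσ : σ = lst A (μ * m - μ * m * σ)) (hσ0 : 0 < σ) (hσ1 : σ < 1)
    (hne : ∀ j ∈ Finset.Icc 1 m, (m : ℝ) * (1 - σ) ≠ j) {q : ℕ → ℕ → ℝ}
    (hq : ∀ n, IsStationarySeq μ A m n (q n)) :
    Tendsto (fun n => q n (m + n) / σ ^ n) atTop
      (𝓝 (constK μ A m σ * (1 + μ * m * deriv (lst A) (μ * m - μ * m * σ)))) := by
  have hm := Q.servers_pos
  have h1σ : 0 < 1 - σ := by linarith
  have hlim := tendsto_tilted Q hσ hσ0 hσ1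
  have hpos := one_add_deriv_pos Q hσ hσ0 hσ1
  set d := 1 + μ * m * deriv (lst A) (μ * m - μ * m * σ) with hd
  -- the mass `w n` of the state `m - 1` and the ratios of the masses above it
  set w : ℕ → ℝ := fun n => q n (m - 1) with hw
  have hwr : ∀ n, w n = stateRatio μ A m (n + 1) * q n (m + n) := fun n => by
    rw [← (hq n).eq_stateRatio_mul Q le_rfl, show m + n - (n + 1) = m - 1 by omega]
  have hw0 : ∀ n, 0 < w n := fun n => by
    rw [hwr]; exact mul_pos (stateRatio_pos Q _) ((hq n).last_pos Q)
  have hqr : ∀ n k, k ≤ n → q n (m + k) / w n =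
      stateRatio μ A m (n - k) / stateRatio μ A m (n + 1) := by
    intro n k hk
    have h1 := (hq n).eq_stateRatio_mul Q (k := n - k) (by omega)
    rw [show m + n - (n - k) = m + k by omega] at h1
    have := ((hq n).last_pos Q).ne'
    rw [h1, hwr, mul_div_mul_right _ _ this]
  have hup : ∀ {γ : ℕ → ℝ} {B : ℝ}, (∀ k, |γ k| ≤ B) →
      Tendsto (fun n => ∑ k ∈ Finset.range (n + 1), q n (m + k) / w n * γ (min (k + 1) n)) atTop
        (𝓝 (∑' k, σ ^ (k + 1) * γ (k + 1))) := by
    intro γ B hγ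
    refine (tendsto_sum_ratio_mul Q hσ hσ0 hσ1 hγ).congr fun n => Finset.sum_congr rfl fun k hk => ?_
    rw [hqr n k (by have := Finset.mem_range.1 hk; omega)]
  have hV : ∀ s ∈ Finset.range m, Tendsto (fun n => ∑ k ∈ Finset.range (n + 1),
      q n (m + k) / w n * busyMoment μ A m (s + 1) (min (k + 1) n)) atTop
      (𝓝 (m.choose (s + 1) * (m * σ) / (m * (1 - σ) - (s + 1 : ℕ)) * (phi μ A (s + 1) - σ))) := by
    intro s hs
    have hs' := Finset.mem_range.1 hs
    have hne' := sub_ne_zero.2 (hne (s + 1) (Finset.mem_Icc.2 ⟨by omega, by omega⟩))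
    rw [← (hasSum_busyMoment Q (s + 1) hσ hσ0 hσ1 hne').tsum_eq]
    exact hup fun k => by
      rw [abs_of_nonneg (busyMoment_nonneg Q _ _)]
      exact busyMoment_le Q (s + 1) k
  have hgeom : ∑' k : ℕ, σ ^ (k + 1) * 1 = σ / (1 - σ) := by
    simp only [mul_one, pow_succ]
    rw [tsum_mul_right, tsum_geometric_of_lt_one hσ0.le hσ1, mul_comm, div_eq_mul_inv]
  have hmass : Tendsto (fun n => ∑ k ∈ Finset.range (n + 1), q n (m + k) / w n) atTop
      (𝓝 (σ / (1 - σ))) := by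
    have := hup (γ := fun _ => 1) (B := 1) (fun k => by simp)
    rw [hgeom] at this
    simpa using this
  have hfirst : Tendsto (fun n => q n m / w n) atTop (𝓝 σ) := by
    have h1 := ((hlim.div (hlim.comp (tendsto_add_atTop_nat 1)) (by positivity))).mul_const σ
    rw [div_self (by positivity), one_mul] at h1
    refine h1.congr fun n => ?_
    have h2 := hqr n 0 (Nat.zero_le n)
    rw [add_zero, Nat.sub_zero] at h2
    have h3 := (stateRatio_pos Q (n + 1)).ne'
    rw [h2]
    simp only [Pi.div_apply, Function.comp_apply, pow_succ]
    field_simp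
  -- normalization, after division by `w n`
  have hinv : ∀ n, (w n)⁻¹ = ∑ s ∈ Finset.range m,
      coeffC μ A (s + 1) / (1 - phi μ A (s + 1)) * (q n m / w n * m.choose (s + 1) -
        ∑ k ∈ Finset.range (n + 1),
          q n (m + k) / w n * busyMoment μ A m (s + 1) (min (k + 1) n)) +
      ∑ k ∈ Finset.range (n + 1), q n (m + k) / w n := by
    intro n
    have h1 := (hq n).sum_eq_one
    rw [add_assoc, Finset.sum_range_add, (hq n).sum_lower_eq Q] at h1
    have h2 := congrArg (· / w n) h1
    simp only [add_div, Finset.sum_div] at h2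
    rw [← one_div, ← h2]
    congr 1
    refine Finset.sum_congr rfl fun s _ => ?_
    rw [mul_div_assoc, sub_div, Finset.sum_div]
    congr 2
    · ring
    · exact Finset.sum_congr rfl fun k _ => by ring
  have hinvlim : Tendsto (fun n => (w n)⁻¹) atTop (𝓝 (σ / (1 - σ) * (constK μ A m σ)⁻¹)) := by
    have h1 := (tendsto_finsetSum (Finset.range m) fun s hs =>
      ((hfirst.mul_const ((m.choose (s + 1) : ℕ) : ℝ)).sub (hV s hs)).const_mul
        (coeffC μ A (s + 1) / (1 - phi μ A (s + 1)))).add hmass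
    simp only [hinv]
    convert h1 using 2
    rw [constK, inv_inv, mul_add, mul_one, add_comm]
    congr 1
    rw [← mul_assoc, div_mul_cancel₀ _ h1σ.ne', Finset.mul_sum,
      Finset.range_eq_Ico, Finset.sum_Ico_add' (fun s : ℕ => coeffC μ A s / (1 - phi μ A s) *
        (σ * (m.choose s : ℝ) - m.choose s * (m * σ) / (m * (1 - σ) - s) * (phi μ A s - σ)))]
    refine Finset.sum_congr (by ext; simp) fun j hj => ?_
    have hj' := sub_ne_zero.2 (hne j hj)
    obtain ⟨i, rfl⟩ : ∃ i, j = i + 1 := ⟨j - 1, by have := Finset.mem_Icc.1 hj; omega⟩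
    have h2 : 1 - phi μ A (i + 1) ≠ 0 := by linarith [phi_succ_lt_one Q i]
    field_simp
    ring
  -- the limit is positive, since `w n ≤ 1`
  have hge : 1 ≤ σ / (1 - σ) * (constK μ A m σ)⁻¹ := by
    refine ge_of_tendsto' hinvlim fun n => (one_le_inv₀ (hw0 n)).2 ?_
    rw [← (hq n).sum_eq_one]
    exact Finset.single_le_sum (fun i _ => (hq n).nonneg i) (Finset.mem_range.2 (by omega))
  have hK : constK μ A m σ ≠ 0 := fun h => by
    rw [h, inv_zero, mul_zero] at hge; linarith
  have hfin := ((hinvlim.inv₀ (by linarith)).div (hlim.comp (tendsto_add_atTop_nat 1))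
    (by positivity)).mul_const σ
  convert hfin using 2
  · rename_i n
    have h3 := (stateRatio_pos Q (n + 1)).ne'
    simp only [Pi.div_apply, Function.comp_apply, inv_inv, hwr, pow_succ]
    field_simp
  · field_simp

end Subcritical

end GIMmn

theorem theorem1 (A : Measure ℝ) [IsProbabilityMeasure A]
    (hA : A (Set.Iio 0) = 0) (hint : Integrable (fun x : ℝ => x) A) (hpos : 0 < ∫ x, x ∂A)
    (μ : ℝ) (hμ : 0 < μ) (m : ℕ) (hm : 1 ≤ m) :
    (∀ n : ℕ, ∃! π : Fin (m + n + 1) → ℝ, GIMmn.IsStationary μ A m n π) ∧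
    ∀ p : ℕ → ℝ, (∀ n : ℕ, GIMmn.IsLossProb μ A m n (p n)) →
      (1 < GIMmn.load μ A m →
        Tendsto p atTop (𝓝 ((GIMmn.load μ A m - 1) / GIMmn.load μ A m))) ∧
      (GIMmn.load μ A m = 1 → Integrable (fun x : ℝ => (μ * m * x) ^ 2) A →
        Tendsto (fun n : ℕ => (n : ℝ) * p n) atTop (𝓝 (GIMmn.rhoMoment μ A m 2 / 2))) ∧
      (GIMmn.load μ A m = 1 → Integrable (fun x : ℝ => (μ * m * x) ^ 3) A →
        (fun n : ℕ => p n - GIMmn.rhoMoment μ A m 2 / (2 * n)) =O[atTop]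
          (fun n : ℕ => Real.log n / (n : ℝ) ^ 2)) ∧
      (GIMmn.load μ A m < 1 →
        ∃ σ : ℝ, GIMmn.IsLeastRoot μ A m σ ∧ σ ∈ Set.Ioo (0 : ℝ) 1 ∧
          ((∀ j ∈ Finset.Icc 1 m, (m : ℝ) * (1 - σ) ≠ j) →
            Tendsto (fun n : ℕ => p n / σ ^ n) atTop
              (𝓝 (GIMmn.constK μ A m σ *
                (1 + μ * m * deriv (GIMmn.lst A) (μ * m - μ * m * σ)))))) := by
  have Q : GIMmn.IsQueue μ A m := ⟨hA, hint, hpos, hμ, hm⟩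
  refine ⟨GIMmn.existsUnique_isStationary Q, fun p hp => ?_⟩
  have hseq : ∀ n, ∃ q, GIMmn.IsStationarySeq μ A m n q ∧ q (m + n) = p n := fun n => by
    obtain ⟨π, hπ, hpπ⟩ := hp n
    rw [hpπ]
    exact hπ.exists_seq Q
  choose q hq hqp using hseq
  obtain rfl : (fun n => q n (m + n)) = p := funext hqp
  refine ⟨fun hρ => GIMmn.tendsto_lossProb_of_one_lt Q hρ hq,
    fun hρ h2 => GIMmn.tendsto_mul_lossProb Q hρ h2 hq,
    fun hρ h3 => GIMmn.isBigO_lossProb_sub Q hρ h3 hq, fun hρ => ?_⟩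
  obtain ⟨σ, hσ, hσ01⟩ := Q.exists_isLeastRoot hρ
  exact ⟨σ, hσ, hσ01, fun hne =>
    GIMmn.tendsto_lossProb_div_pow Q hσ.1 hσ01.1 hσ01.2 hne hq⟩
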